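/- **Setup.** A formal group law (FGL) over a commutative ring $R$ is a commutative one-dimensional formal group law $F(x,y)=x+_Fy\in R[[x,y]]$; it is *of additive type* if its formal inverse is $-x$, i.e. $F(x,-x)=0$. A morphism $(\phi,\gamma)\colon F_1/R_1\to F_2/R_2$ is a ring homomorphism $\phi\colon R_1\to R_2$ together with $\gamma\in R_2[[x]]$, $\gamma(0)=0$, such that $\phi(F_1)(\gamma(x),\gamma(y))=\gamma(F_2(x,y))$. Its inverse Todd genus is $\mathrm{itd}(x)=\gamma(x)/x\in R_2[[x]]$. Let $G$ be a split semisimple linear algebraic group with split maximal torus $T$ and Borel subgroup $B\supset T$, given by its (reduced, semisimple) root datum with character lattice $\Lambda=T^*$, set of roots $\Sigma$ and Weyl group $W$. For an FGL $F/R$ let $S=S_F(\Lambda)$ be the formal group ring: the quotient of the completion $R[[x_\lambda]]_{\lambda\in\Lambda}$ of the polynomial ring $R[x_\lambda]_{\lambda\in\Lambda}$ at the kernel of the augmentation $x_\lambda\mapsto 0$ by the closure of the ideal generated by $x_0$ and all $x_{\lambda+\mu}-(x_\lambda+_Fx_\mu)$. The group $W$ acts on $S$ by $w(x_\lambda)=x_{w(\lambda)}$.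 Let $Q=S[\tfrac1{x_\alpha},\alpha\in\Sigma]$, and let $Q_W$ be the twisted group algebra, the free left $Q$-module with basis $\delta_w$ $(w\in W)$ and product $(q\delta_w)(q'\delta_v)=q\,w(q')\,\delta_{wv}$. For a root $\alpha$ let $$Y_\alpha=\tfrac1{x_{-\alpha}}+\tfrac1{x_\alpha}\delta_{s_\alpha}\in Q_W$$ be the push-pull element, and let $\mathbf D_F\subset Q_W$ be the subring generated by $S$ and all $Y_\alpha$, $\alpha\in\Sigma$; it contains all $\delta_w$. The $T$-equivariant oriented cohomology of the flag variety for the theory with FGL $F$ is identified with the dual $$\mathsf h_T(G/B)=\mathbf D_F^\star=\mathrm{Hom}_S(\mathbf D_F,S)$$ of the left $S$-module $\mathbf D_F$. The restriction to the $T$-fixed points is $\mathbf D_F^\star\to S_W^\star=\mathrm{Hom}(W,S)$, $f\mapsto (f(\delta_w))_{w\in W}$, and $\mathbf D_F$ acts on $\mathbf D_F^\star$ by the Hecke action $(z\bullet f)(z')=f(z'z)$. A morphism $(\phi,\gamma)\colon F_1/R_1\to F_2/R_2$ induces a ring homomorphism $\mathcal C\colon S_1=S_{F_1}(\Lambda)\to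 S_2=S_{F_2}(\Lambda)$, $f(x_\lambda,\dots)\mapsto\phi(f)(\gamma(x_\lambda),\dots)$. A localized multiplicative operation induced by $(\phi,\gamma)$ is an additive map $\mathcal C_T\colon(\mathsf h_1)_T(G/B)\to(\mathsf h_2)_T(G/B)$ that becomes, after restriction to the fixed points, the map $\mathrm{Hom}(W,S_1)\to\mathrm{Hom}(W,S_2)$ applying $\mathcal C$ to every component. **Proposition.** Suppose that $F_1$ and $F_2$ are of additive type, that $(\phi,\gamma)\colon F_1/R_1\to F_2/R_2$ is a morphism, and that $S_1$ and $S_2$ are $\Sigma$-regular (every $x_\alpha$, $\alpha\in\Sigma$, is a regular element). Then there is exactly one localized multiplicative operation $\mathcal C_T\colon(\mathsf h_1)_T(G/B)\to(\mathsf h_2)_T(G/B)$ induced by $(\phi,\gamma)$, and for every root $\alpha$ $$\mathrm{itd}(x_\alpha)\bullet\mathcal C_T(Y_\alpha\bullet z)=Y_\alpha\bullet\mathcal C_T(z)\qquad\text{for all } z\in(\mathsf h_1)_T(G/B).$$ -/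

import Mathlib

noncomputable section

namespace FlagOp

open MvPowerSeries

/-! ### Completed polynomial rings -/

/-- The completion `R[[x_s]]` of the polynomial ring `R[x_s]`, `s ∈ σ`, at the kernel of the
augmentation map `x_s ↦ 0`. It is realized as the set of all formal power series which, for every
`n`, agree with some polynomial up to terms of total degree `≥ n` (equivalently, all of whose
homogeneous components are polynomials). For infinite `σ` this is smaller than the ring of
all formal power series. -/
def completedPolynomialRing (σ R : Type*) [CommRing R] : Subalgebra R (MvPowerSeries σ R) where
  carrier := {f | ∀ n : ℕ, ∃ p : MvPolynomial σ R, (n : ℕ∞) ≤ (f - (p : MvPowerSeries σ R)).order}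
  mul_mem' := by
    intro f g hf hg n
    obtain ⟨p, hp⟩ := hf n
    obtain ⟨q, hq⟩ := hg n
    refine ⟨p * q, ?_⟩
    have : f * g - ((p * q : MvPolynomial σ R) : MvPowerSeries σ R)
        = f * (g - (q : MvPowerSeries σ R)) + (f - (p : MvPowerSeries σ R)) * q := by
      rw [MvPolynomial.coe_mul]; ring
    rw [this]
    refine le_trans (le_min ?_ ?_) min_order_le_add
    · exact le_trans (hq.trans le_add_self) le_order_mul
    · exact le_trans (hp.trans le_self_add) le_order_mul
  add_mem' := by
    intro f g hf hg n
    obtain ⟨p, hp⟩ := hf n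
    obtain ⟨q, hq⟩ := hg n
    refine ⟨p + q, ?_⟩
    have : f + g - ((p + q : MvPolynomial σ R) : MvPowerSeries σ R)
        = (f - (p : MvPowerSeries σ R)) + (g - (q : MvPowerSeries σ R)) := by
      rw [MvPolynomial.coe_add]; ring
    rw [this]
    exact le_trans (le_min hp hq) min_order_le_add
  algebraMap_mem' := by
    intro r n
    refine ⟨MvPolynomial.C r, ?_⟩
    simp [MvPowerSeries.algebraMap_apply]

section Completed

variable {σ τ R R' : Type*} [CommRing R] [CommRing R']

theorem coe_mem (p : MvPolynomial σ R) :
    (p : MvPowerSeries σ R) ∈ completedPolynomialRing σ R := fun n => ⟨p, by simp⟩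

theorem X_mem (s : σ) : (X s : MvPowerSeries σ R) ∈ completedPolynomialRing σ R := by
  simpa using coe_mem (MvPolynomial.X s : MvPolynomial σ R)

theorem C_mem (r : R) : (C r : MvPowerSeries σ R) ∈ completedPolynomialRing σ R := by
  simpa using coe_mem (MvPolynomial.C r : MvPolynomial σ R)

theorem mem_of_approx {f : MvPowerSeries σ R}
    (h : ∀ n : ℕ, ∃ g ∈ completedPolynomialRing σ R, (n : ℕ∞) ≤ (f - g).order) :
    f ∈ completedPolynomialRing σ R := by
  intro n
  obtain ⟨g, hg, hfg⟩ := h n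
  obtain ⟨p, hp⟩ := hg n
  refine ⟨p, ?_⟩
  have : f - (p : MvPowerSeries σ R) = (f - g) + (g - (p : MvPowerSeries σ R)) := by ring
  rw [this]
  exact le_trans (le_min hfg hp) min_order_le_add

theorem map_mem (Φ : MvPowerSeries σ R →+* MvPowerSeries τ R')
    (hC : ∀ r, Φ (C r) ∈ completedPolynomialRing τ R')
    (hX : ∀ s, Φ (X s) ∈ completedPolynomialRing τ R')
    (hord : ∀ f, f.order ≤ (Φ f).order)
    {f : MvPowerSeries σ R} (hf : f ∈ completedPolynomialRing σ R) :
    Φ f ∈ completedPolynomialRing τ R' := by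
  refine mem_of_approx fun n => ?_
  obtain ⟨p, hp⟩ := hf n
  refine ⟨Φ p, ?_, ?_⟩
  · clear hp
    induction p using MvPolynomial.induction_on with
    | C r => simpa using hC r
    | add p q hp hq =>
      rw [MvPolynomial.coe_add, map_add]
      exact add_mem hp hq
    | mul_X p s hp =>
      rw [MvPolynomial.coe_mul, MvPolynomial.coe_X, map_mul]
      exact mul_mem hp (hX s)
  · rw [← map_sub]
    exact hp.trans (hord _)

theorem mem_of_finite [Finite σ] (f : MvPowerSeries σ R) : f ∈ completedPolynomialRing σ R := by
  intro n
  refine ⟨truncTotal n f, ?_⟩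
  apply nat_le_order
  intro d hd
  rw [map_sub, MvPolynomial.coeff_coe, coeff_truncTotal _ hd, sub_self]

theorem order_le_subst {a : σ → MvPowerSeries τ R} (ha : HasSubst a)
    (ha' : ∀ i, constantCoeff (a i) = 0) (f : MvPowerSeries σ R) :
    f.order ≤ (f.subst a).order := by
  refine le_trans ?_ (le_order_subst ha f)
  refine ENat.self_le_mul_left _ ?_
  rw [← Order.one_le_iff_ne_zero]
  exact le_iInf fun i => Order.one_le_iff_ne_zero.mpr
    ((order_ne_zero_iff_constCoeff_eq_zero (f := a i)).mpr (ha' i))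

/-- Substituting elements without constant term of the completion into a power series in finitely
many variables gives an element of the completion. -/
theorem subst_mem [Finite σ] {a : σ → MvPowerSeries τ R}
    (ha : ∀ i, a i ∈ completedPolynomialRing τ R) (ha' : ∀ i, constantCoeff (a i) = 0)
    (f : MvPowerSeries σ R) : f.subst a ∈ completedPolynomialRing τ R := by
  have hs : HasSubst a := hasSubst_of_constantCoeff_zero ha'
  have := map_mem (substAlgHom hs : MvPowerSeries σ R →ₐ[R] MvPowerSeries τ R).toRingHom
    (fun r => by
      have : (substAlgHom hs : MvPowerSeries σ R →ₐ[R] MvPowerSeries τ R) (C r) = C r := by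
        rw [substAlgHom_apply, subst_C]
      simpa [this] using C_mem (σ := τ) r)
    (fun s => by simpa [subst_X hs] using ha s)
    (fun g => by simpa using order_le_subst hs ha' g)
    (mem_of_finite f)
  simpa using this

theorem powerSeries_subst_mem {a : MvPowerSeries τ R}
    (ha : a ∈ completedPolynomialRing τ R) (ha' : constantCoeff a = 0) (f : PowerSeries R) :
    f.subst a ∈ completedPolynomialRing τ R :=
  subst_mem (σ := Unit) (a := fun _ => a) (fun _ => ha) (fun _ => ha') f

/-- The closure of an ideal of the completed polynomial ring: the elements that agree
with an element of the ideal up to terms of total degree `≥ n`, for every `n`. -/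
def idealClosure (J : Ideal (completedPolynomialRing σ R)) :
    Ideal (completedPolynomialRing σ R) where
  carrier := {f | ∀ n : ℕ, ∃ j ∈ J, (n : ℕ∞) ≤ ((f - j : completedPolynomialRing σ R) :
    MvPowerSeries σ R).order}
  add_mem' := by
    intro f g hf hg n
    obtain ⟨p, hp, hp'⟩ := hf n
    obtain ⟨q, hq, hq'⟩ := hg n
    refine ⟨p + q, add_mem hp hq, ?_⟩
    have : ((f + g - (p + q) : completedPolynomialRing σ R) : MvPowerSeries σ R)
        = ((f - p : completedPolynomialRing σ R) : MvPowerSeries σ R)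
          + ((g - q : completedPolynomialRing σ R) : MvPowerSeries σ R) := by
      push_cast; ring
    rw [this]
    exact le_trans (le_min hp' hq') min_order_le_add
  zero_mem' := fun n => ⟨0, zero_mem _, by simp⟩
  smul_mem' := by
    intro c f hf n
    obtain ⟨p, hp, hp'⟩ := hf n
    refine ⟨c * p, J.mul_mem_left c hp, ?_⟩
    have : ((c • f - c * p : completedPolynomialRing σ R) : MvPowerSeries σ R)
        = (c : MvPowerSeries σ R) * ((f - p : completedPolynomialRing σ R) :
          MvPowerSeries σ R) := by
      rw [smul_eq_mul]; push_cast; ring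
    rw [this]
    exact le_trans (hp'.trans le_add_self) le_order_mul

theorem le_idealClosure (J : Ideal (completedPolynomialRing σ R)) : J ≤ idealClosure J :=
  fun f hf n => ⟨f, hf, by simp⟩

theorem idealClosure_map
    (Φ : completedPolynomialRing σ R →+* completedPolynomialRing τ R')
    (hord : ∀ f : completedPolynomialRing σ R,
      (f : MvPowerSeries σ R).order ≤ (Φ f : MvPowerSeries τ R').order)
    {J : Ideal (completedPolynomialRing σ R)} {J' : Ideal (completedPolynomialRing τ R')}
    (h : J ≤ (idealClosure J').comap Φ) :
    idealClosure J ≤ (idealClosure J').comap Φ := by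
  intro f hf n
  obtain ⟨j, hj, hj'⟩ := hf n
  obtain ⟨k, hk, hk'⟩ := h hj n
  refine ⟨k, hk, ?_⟩
  have : ((Φ f - k : completedPolynomialRing τ R') : MvPowerSeries τ R')
      = (Φ (f - j) : MvPowerSeries τ R')
        + ((Φ j - k : completedPolynomialRing τ R') : MvPowerSeries τ R') := by
    rw [map_sub]; push_cast; ring
  rw [this]
  exact le_trans (le_min (hj'.trans (hord _)) hk') min_order_le_add

end Completed

/-! ### Formal group laws and their morphisms -/

section FGL

variable {R R₁ R₂ : Type*} [CommRing R] [CommRing R₁] [CommRing R₂]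

/-- `g` is the formal inverse of the formal group law `F`: `x +_F g(x) = 0`. -/
def IsFormalInverse (F : FormalGroup R) (g : PowerSeries R) : Prop :=
  PowerSeries.constantCoeff g = 0 ∧
    F.toPowerSeries.subst ![(PowerSeries.X : PowerSeries R), g] = (0 : PowerSeries R)

/-- `F` is of additive type: its formal inverse is the usual additive inverse, `-_F x = -x`. -/
def IsAdditiveType (F : FormalGroup R) : Prop := IsFormalInverse F (-PowerSeries.X)

/-- A morphism `(φ, γ)` from `F₁` over `R₁` to `F₂` over `R₂`: a ring homomorphism `φ : R₁ → R₂`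
and a power series `γ` over `R₂` without constant term such that
`φ(F₁)(γ(x), γ(y)) = γ(F₂(x, y))`. -/
structure FGLMorphism (F₁ : FormalGroup R₁) (F₂ : FormalGroup R₂) where
  /-- The homomorphism of the coefficient rings. -/
  φ : R₁ →+* R₂
  /-- The power series. -/
  γ : PowerSeries R₂
  constantCoeff_γ : PowerSeries.constantCoeff γ = 0
  map_add : (F₁.map φ).toPowerSeries.subst
      ![γ.subst (X 0 : MvPowerSeries (Fin 2) R₂), γ.subst (X 1 : MvPowerSeries (Fin 2) R₂)]
    = γ.subst F₂.toPowerSeries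

/-- The inverse Todd genus `itd(x) = γ(x) / x`. -/
def FGLMorphism.itd {F₁ : FormalGroup R₁} {F₂ : FormalGroup R₂} (c : FGLMorphism F₁ F₂) :
    PowerSeries R₂ :=
  PowerSeries.mk fun n => PowerSeries.coeff (n + 1) c.γ

theorem FGLMorphism.X_mul_itd {F₁ : FormalGroup R₁} {F₂ : FormalGroup R₂}
    (c : FGLMorphism F₁ F₂) : PowerSeries.X * c.itd = c.γ := by
  ext n
  cases n with
  | zero => simp [c.constantCoeff_γ]
  | succ n => simp [FGLMorphism.itd]

end FGL

/-! ### Formal group rings -/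

section FormalGroupRing

variable {R : Type*} [CommRing R] (F : FormalGroup R) (Λ : Type*) [AddCommGroup Λ]

/-- The variable `x_lam` in the completed polynomial ring. -/
def xHat (R : Type*) [CommRing R] {Λ : Type*} (lam : Λ) : completedPolynomialRing Λ R :=
  ⟨X lam, X_mem lam⟩

variable {Λ} in
/-- The formal sum `x_lam +_F x_mu` in the completed polynomial ring. -/
def xHatAdd (lam mu : Λ) : completedPolynomialRing Λ R :=
  ⟨F.toPowerSeries.subst ![(X lam : MvPowerSeries Λ R), X mu],
    subst_mem (by intro i; fin_cases i <;> exact X_mem _) (by intro i; fin_cases i <;> simp) _⟩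

/-- The ideal of the relations `x_0 = 0` and `x_{lam + mu} = x_lam +_F x_mu`. -/
def relationIdeal : Ideal (completedPolynomialRing Λ R) :=
  Ideal.span ({xHat R (0 : Λ)} ∪
    Set.range fun p : Λ × Λ => xHat R (p.1 + p.2) - xHatAdd F p.1 p.2)

/-- The formal group ring `S_F(Λ)`: the quotient of the completed polynomial ring in
the variables `x_lam`, `lam ∈ Λ`, by the closure of the ideal of relations. -/
def FormalGroupRing : Type _ :=
  completedPolynomialRing Λ R ⧸ idealClosure (relationIdeal F Λ)

instance : CommRing (FormalGroupRing F Λ) :=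
  inferInstanceAs (CommRing (completedPolynomialRing Λ R ⧸ idealClosure (relationIdeal F Λ)))

/-- The quotient map onto the formal group ring. -/
def FormalGroupRing.mk : completedPolynomialRing Λ R →+* FormalGroupRing F Λ :=
  Ideal.Quotient.mk (idealClosure (relationIdeal F Λ))

variable {Λ}

/-- The class `x_lam` in the formal group ring. -/
def xVar (lam : Λ) : FormalGroupRing F Λ := FormalGroupRing.mk F Λ (xHat R lam)

/-- The value `f(x_lam)` in the formal group ring of a power series `f` over `R`. -/
def seriesAt (f : PowerSeries R) (lam : Λ) : FormalGroupRing F Λ :=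
  FormalGroupRing.mk F Λ ⟨f.subst (X lam : MvPowerSeries Λ R),
    powerSeries_subst_mem (X_mem lam) (by simp) f⟩

end FormalGroupRing

/-! ### Functoriality: the action of a group on the lattice and the operation `C` -/

section Action

variable {R : Type*} [CommRing R] (F : FormalGroup R) {Λ : Type*} [AddCommGroup Λ]
variable {G : Type*} [Group G] [DistribMulAction G Λ]

variable (R) in
/-- The automorphism `x_lam ↦ x_{g lam}` of the completed polynomial ring. -/
def actHat (g : G) : completedPolynomialRing Λ R →+* completedPolynomialRing Λ R :=
  ((renameEquiv R (MulAction.toPerm g : Λ ≃ Λ) :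
      MvPowerSeries Λ R ≃ₐ[R] MvPowerSeries Λ R) : MvPowerSeries Λ R →+* MvPowerSeries Λ R).restrict
    (completedPolynomialRing Λ R) (completedPolynomialRing Λ R) fun f hf => by
      refine map_mem _ (fun r => ?_) (fun s => ?_) (fun f => ?_) hf
      · simpa using C_mem r
      · simpa using X_mem _
      · have h := order_le_subst (HasSubst.X_comp (MulAction.toPerm g : Λ ≃ Λ)) (by simp) f
        rw [← rename_eq_subst] at h
        simpa using h

theorem coe_actHat (g : G) (f : completedPolynomialRing Λ R) :
    (actHat R g f : MvPowerSeries Λ R) = rename (MulAction.toPerm g : Λ ≃ Λ) f.1 := rfl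

theorem coe_actHat' (g : G) (f : completedPolynomialRing Λ R) :
    (actHat R g f : MvPowerSeries Λ R) = renameEquiv R (MulAction.toPerm g : Λ ≃ Λ) f.1 := rfl

theorem order_le_actHat (g : G) (f : completedPolynomialRing Λ R) :
    (f : MvPowerSeries Λ R).order ≤ (actHat R g f : MvPowerSeries Λ R).order := by
  have h := order_le_subst (HasSubst.X_comp (MulAction.toPerm g : Λ ≃ Λ)) (by simp)
    (f : MvPowerSeries Λ R)
  rwa [← rename_eq_subst] at h

theorem actHat_xHat (g : G) (lam : Λ) : actHat R g (xHat R lam) = xHat R (g • lam) := by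
  apply Subtype.ext
  rw [coe_actHat]
  simp [xHat]

theorem actHat_xHatAdd (g : G) (lam mu : Λ) :
    actHat R g (xHatAdd F lam mu) = xHatAdd F (g • lam) (g • mu) := by
  apply Subtype.ext
  rw [coe_actHat, rename_eq_subst]
  simp only [xHatAdd]
  rw [subst_comp_subst_apply HasSubst.X_X (HasSubst.X_comp _)]
  congr 1
  funext i
  fin_cases i <;> simp [subst_X (HasSubst.X_comp (MulAction.toPerm g : Λ ≃ Λ))]

theorem actHat_one (f : completedPolynomialRing Λ R) : actHat R (1 : G) f = f := by
  apply Subtype.ext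
  have : (MulAction.toPerm (1 : G) : Λ ≃ Λ) = Equiv.refl Λ := by ext; simp
  rw [coe_actHat']
  rw [this, renameEquiv_refl]
  rfl

theorem actHat_mul (g h : G) (f : completedPolynomialRing Λ R) :
    actHat R (g * h) f = actHat R g (actHat R h f) := by
  apply Subtype.ext
  have : (MulAction.toPerm (g * h) : Λ ≃ Λ)
      = (MulAction.toPerm h : Λ ≃ Λ).trans (MulAction.toPerm g) := by ext; simp [mul_smul]
  rw [coe_actHat', coe_actHat', coe_actHat', this, ← renameEquiv_trans]
  rfl

theorem idealClosure_le_comap_actHat (g : G) :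
    idealClosure (relationIdeal F Λ) ≤ (idealClosure (relationIdeal F Λ)).comap (actHat R g) := by
  refine idealClosure_map _ (order_le_actHat g) ?_
  refine le_trans ?_ (Ideal.comap_mono (le_idealClosure _))
  rw [relationIdeal, Ideal.span_le]
  rintro f (hf | ⟨⟨lam, mu⟩, rfl⟩)
  · rw [Set.mem_singleton_iff] at hf
    subst hf
    rw [SetLike.mem_coe, Ideal.mem_comap, actHat_xHat, smul_zero]
    exact Ideal.subset_span (Or.inl rfl)
  · rw [SetLike.mem_coe, Ideal.mem_comap, map_sub, actHat_xHat, actHat_xHatAdd, smul_add]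
    exact Ideal.subset_span (Or.inr ⟨(g • lam, g • mu), rfl⟩)

/-- The automorphism of the formal group ring induced by `g`. -/
def actHom (g : G) : FormalGroupRing F Λ →+* FormalGroupRing F Λ :=
  Ideal.quotientMap _ (actHat R g) (idealClosure_le_comap_actHat F g)

theorem actHom_mk (g : G) (f : completedPolynomialRing Λ R) :
    actHom F g (FormalGroupRing.mk F Λ f) = FormalGroupRing.mk F Λ (actHat R g f) := rfl

theorem mk_surjective : Function.Surjective (FormalGroupRing.mk F Λ) :=
  Ideal.Quotient.mk_surjective

/-- A group acting on the lattice `Λ` acts on the formal group ring by functoriality. -/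
instance : MulSemiringAction G (FormalGroupRing F Λ) where
  smul g s := actHom F g s
  one_smul s := by
    obtain ⟨f, rfl⟩ := mk_surjective F s
    change actHom F (1 : G) _ = _
    rw [actHom_mk, actHat_one]
  mul_smul g h s := by
    obtain ⟨f, rfl⟩ := mk_surjective F s
    change actHom F (g * h) _ = actHom F g (actHom F h _)
    rw [actHom_mk, actHom_mk, actHom_mk, actHat_mul]
  smul_zero g := map_zero (actHom F g)
  smul_add g := map_add (actHom F g)
  smul_one g := map_one (actHom F g)
  smul_mul g := map_mul (actHom F g)

theorem smul_xVar (g : G) (lam : Λ) : g • xVar F lam = xVar F (g • lam) := by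
  change actHom F g _ = _
  rw [xVar, actHom_mk, actHat_xHat]
  rfl

end Action

section Operation

variable {R₁ R₂ : Type*} [CommRing R₁] [CommRing R₂] {F₁ : FormalGroup R₁} {F₂ : FormalGroup R₂}
variable (c : FGLMorphism F₁ F₂) (Λ : Type*)

theorem hasSubst_γ : HasSubst (fun lam : Λ => c.γ.subst (X lam : MvPowerSeries Λ R₂)) where
  const_coeff lam := by
    have h : constantCoeff (c.γ.subst (X lam : MvPowerSeries Λ R₂)) = 0 :=
      PowerSeries.constantCoeff_subst_eq_zero (by simp) _ c.constantCoeff_γ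
    rw [h]
    exact IsNilpotent.zero
  coeff_zero d := by
    classical
    refine d.support.finite_toSet.subset fun lam hlam => ?_
    rw [Set.mem_ofPred_eq, PowerSeries.coeff_subst_single] at hlam
    by_contra h
    rw [Finset.mem_coe, Finsupp.notMem_support_iff] at h
    rw [h] at hlam
    simp [c.constantCoeff_γ] at hlam

theorem constantCoeff_γ_subst (lam : Λ) :
    constantCoeff (c.γ.subst (X lam : MvPowerSeries Λ R₂)) = 0 :=
  PowerSeries.constantCoeff_subst_eq_zero (by simp) _ c.constantCoeff_γ

/-- The homomorphism `f(x_lam, …) ↦ φ(f)(γ(x_lam), …)` of rings of formal power series. -/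
def operationSeries : MvPowerSeries Λ R₁ →+* MvPowerSeries Λ R₂ :=
  ((substAlgHom (hasSubst_γ c Λ) : MvPowerSeries Λ R₂ →ₐ[R₂] MvPowerSeries Λ R₂) :
    MvPowerSeries Λ R₂ →+* MvPowerSeries Λ R₂).comp (MvPowerSeries.map c.φ)

theorem operationSeries_apply (f : MvPowerSeries Λ R₁) :
    operationSeries c Λ f =
      (MvPowerSeries.map c.φ f).subst (fun lam : Λ => c.γ.subst (X lam : MvPowerSeries Λ R₂)) := by
  simp [operationSeries]

theorem order_le_operationSeries (f : MvPowerSeries Λ R₁) :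
    f.order ≤ (operationSeries c Λ f).order := by
  rw [operationSeries_apply]
  exact (le_order_map c.φ).trans (order_le_subst (hasSubst_γ c Λ) (constantCoeff_γ_subst c Λ) _)

/-- The induced homomorphism of completed polynomial rings,
`f(x_lam, …) ↦ φ(f)(γ(x_lam), …)`. -/
def operationHat : completedPolynomialRing Λ R₁ →+* completedPolynomialRing Λ R₂ :=
  (operationSeries c Λ).restrict (completedPolynomialRing Λ R₁) (completedPolynomialRing Λ R₂)
    fun f hf => by
      refine map_mem _ (fun r => ?_) (fun s => ?_) (order_le_operationSeries c Λ) hf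
      · rw [operationSeries_apply, map_C, subst_C]
        exact C_mem _
      · rw [operationSeries_apply, map_X, subst_X (hasSubst_γ c Λ)]
        exact powerSeries_subst_mem (X_mem _) (by simp) _

theorem coe_operationHat (f : completedPolynomialRing Λ R₁) :
    (operationHat c Λ f : MvPowerSeries Λ R₂) = operationSeries c Λ f.1 := rfl

theorem coe_operationHat_xHat {Λ : Type*} (lam : Λ) :
    (operationHat c Λ (xHat R₁ lam) : MvPowerSeries Λ R₂) = c.γ.subst (X lam) := by
  rw [coe_operationHat, operationSeries_apply, xHat, map_X, subst_X (hasSubst_γ c Λ)]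

theorem order_sub_trunc (f : PowerSeries R₂) (n : ℕ) :
    (n : ℕ∞) ≤ (f - (PowerSeries.trunc n f : PowerSeries R₂)).order := by
  apply PowerSeries.nat_le_order
  intro i hi
  simp [PowerSeries.coeff_trunc, hi]

/-- Substitution into a power series preserves congruences modulo a closed ideal. -/
theorem subst_sub_subst_mem {τ : Type*} (f : PowerSeries R₂) {J : Ideal (completedPolynomialRing τ R₂)}
    {a b : completedPolynomialRing τ R₂} (ha : constantCoeff a.1 = 0) (hb : constantCoeff b.1 = 0)
    (hab : a - b ∈ J) :
    (⟨f.subst a.1, powerSeries_subst_mem a.2 ha f⟩ - ⟨f.subst b.1, powerSeries_subst_mem b.2 hb f⟩ :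
      completedPolynomialRing τ R₂) ∈ idealClosure J := by
  intro n
  refine ⟨Polynomial.aeval a (PowerSeries.trunc n f) - Polynomial.aeval b (PowerSeries.trunc n f),
    ?_, ?_⟩
  · rw [Polynomial.aeval_def, Polynomial.aeval_def, Polynomial.eval₂_eq_eval_map,
      Polynomial.eval₂_eq_eval_map]
    exact J.mem_of_dvd (Polynomial.sub_dvd_eval_sub a b _) hab
  · have key : ∀ d : completedPolynomialRing τ R₂, constantCoeff d.1 = 0 →
        (n : ℕ∞) ≤ (f.subst d.1 - (Polynomial.aeval d (PowerSeries.trunc n f) :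
          completedPolynomialRing τ R₂).1).order := by
      intro d hd
      have hs : PowerSeries.HasSubst d.1 := PowerSeries.HasSubst.of_constantCoeff_zero hd
      have h1 : (Polynomial.aeval d (PowerSeries.trunc n f) : completedPolynomialRing τ R₂).1
          = PowerSeries.subst d.1 (PowerSeries.trunc n f : PowerSeries R₂) := by
        rw [PowerSeries.subst_coe hs, Polynomial.aeval_subalgebra_coe]
      rw [h1, ← PowerSeries.subst_sub hs]
      exact (order_sub_trunc f n).trans (PowerSeries.le_order_subst_left hd)
    have h2 : ∀ u v w z : completedPolynomialRing τ R₂,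
        ((u - v - (w - z) : completedPolynomialRing τ R₂) : MvPowerSeries τ R₂)
          = (u.1 - w.1) + -(v.1 - z.1) := by
      intro u v w z
      push_cast
      ring
    rw [h2]
    refine le_trans (le_min (key a ha) ?_) min_order_le_add
    rw [order_neg]
    exact key b hb

theorem operationHat_xHatAdd {Λ : Type*} (lam mu : Λ) :
    (operationHat c Λ (xHatAdd F₁ lam mu) : MvPowerSeries Λ R₂)
      = c.γ.subst (F₂.toPowerSeries.subst ![(X lam : MvPowerSeries Λ R₂), X mu]) := by
  have hXX : HasSubst ![(X lam : MvPowerSeries Λ R₂), X mu] := HasSubst.X_X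
  have h := congrArg (MvPowerSeries.subst ![(X lam : MvPowerSeries Λ R₂), X mu]) c.map_add
  have h0 : ∀ i : Fin 2, PowerSeries.HasSubst (X i : MvPowerSeries (Fin 2) R₂) :=
    fun i => PowerSeries.HasSubst.X i
  have hγ : ∀ i : Fin 2, constantCoeff (c.γ.subst (X i : MvPowerSeries (Fin 2) R₂)) = 0 :=
    constantCoeff_γ_subst c (Fin 2)
  have hF : PowerSeries.HasSubst F₂.toPowerSeries :=
    PowerSeries.HasSubst.of_constantCoeff_zero F₂.zero_constantCoeff
  rw [PowerSeries.subst_def, PowerSeries.subst_def, PowerSeries.subst_def,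
    subst_comp_subst_apply (hasSubst_of_constantCoeff_zero (by intro i; fin_cases i <;> exact hγ _))
      hXX, subst_comp_subst_apply hF.const hXX] at h
  rw [coe_operationHat, operationSeries_apply, PowerSeries.subst_def, ← h]
  simp only [xHatAdd]
  rw [map_subst HasSubst.X_X, subst_comp_subst_apply _ (hasSubst_γ c Λ)]
  · congr 1
    funext i
    fin_cases i
    · change subst _ (MvPowerSeries.map c.φ (X lam : MvPowerSeries Λ R₁))
        = subst _ (subst (fun _ => (X 0 : MvPowerSeries (Fin 2) R₂)) c.γ)
      rw [subst_comp_subst_apply (h0 0).const hXX, map_X, subst_X (hasSubst_γ c Λ)]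
      simp only [subst_X hXX]
      rfl
    · change subst _ (MvPowerSeries.map c.φ (X mu : MvPowerSeries Λ R₁))
        = subst _ (subst (fun _ => (X 1 : MvPowerSeries (Fin 2) R₂)) c.γ)
      rw [subst_comp_subst_apply (h0 1).const hXX, map_X, subst_X (hasSubst_γ c Λ)]
      simp only [subst_X hXX]
      rfl
  · exact hasSubst_of_constantCoeff_zero (by intro i; fin_cases i <;> simp)

variable [AddCommGroup Λ]

theorem idealClosure_le_comap_operationHat :
    idealClosure (relationIdeal F₁ Λ) ≤
      (idealClosure (relationIdeal F₂ Λ)).comap (operationHat c Λ) := by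
  refine idealClosure_map _ (fun f => order_le_operationSeries c Λ _) ?_
  rw [relationIdeal, Ideal.span_le]
  have hadd : ∀ lam mu : Λ, constantCoeff (xHatAdd F₂ lam mu).1 = 0 := fun lam mu =>
    constantCoeff_subst_eq_zero HasSubst.X_X (by intro i; fin_cases i <;> simp)
      F₂.zero_constantCoeff
  rintro f (hf | ⟨⟨lam, mu⟩, rfl⟩)
  · rw [Set.mem_singleton_iff] at hf
    subst hf
    have h := subst_sub_subst_mem c.γ (J := relationIdeal F₂ Λ) (a := xHat R₂ (0 : Λ)) (b := 0)
      (by simp [xHat]) (by simp)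
      (by rw [sub_zero]; exact Ideal.subset_span (Or.inl rfl))
    rw [SetLike.mem_coe, Ideal.mem_comap]
    convert h using 1
    apply Subtype.ext
    rw [coe_operationHat_xHat]
    simp [xHat, PowerSeries.subst_zero_of_constantCoeff_zero c.constantCoeff_γ]
  · have h := subst_sub_subst_mem c.γ (J := relationIdeal F₂ Λ)
      (a := xHat R₂ (lam + mu)) (b := xHatAdd F₂ lam mu)
      (by simp [xHat]) (hadd lam mu) (Ideal.subset_span (Or.inr ⟨(lam, mu), rfl⟩))
    rw [SetLike.mem_coe, Ideal.mem_comap, map_sub]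
    convert h using 1
    apply Subtype.ext
    change (operationHat c Λ (xHat R₁ (lam + mu))).1 - (operationHat c Λ (xHatAdd F₁ lam mu)).1 = _
    rw [coe_operationHat_xHat, operationHat_xHatAdd]
    rfl

/-- The operation `C : S_{F₁}(Λ) → S_{F₂}(Λ)` on formal group rings induced by the morphism
`(φ, γ)`; it is `φ` on coefficients and maps `x_lam` to `γ(x_lam)`. -/
def operation : FormalGroupRing F₁ Λ →+* FormalGroupRing F₂ Λ :=
  Ideal.quotientMap _ (operationHat c Λ) (idealClosure_le_comap_operationHat c Λ)

theorem operation_xVar {Λ : Type*} [AddCommGroup Λ] (lam : Λ) :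
    operation c Λ (xVar F₁ lam) = seriesAt F₂ c.γ lam := by
  change FormalGroupRing.mk F₂ Λ (operationHat c Λ (xHat R₁ lam)) = _
  congr 1
  exact Subtype.ext (coe_operationHat_xHat c lam)

end Operation

/-! ### Root data, twisted group algebras and the formal affine Demazure algebra -/

section Flag

variable {ι M N : Type*} [AddCommGroup M] [AddCommGroup N] (P : RootDatum ι M N)
variable {R : Type*} [CommRing R] (F : FormalGroup R)

/-- A root datum is semisimple if its roots span a subgroup of full rank in the character
lattice. -/
def IsSemisimple : Prop :=
  ∀ m : M, ∃ n : ℕ, n ≠ 0 ∧ n • m ∈ AddSubgroup.closure (Set.range P.root)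

/-- The formal group ring `S = S_F(Λ)` of the character lattice `Λ = M` is `Σ`-regular: all `x_α`,
for `α` a root, are regular elements. -/
def IsSigmaRegular : Prop := ∀ i : ι, IsRegular (xVar F (P.root i))

/-- The multiplicative subset generated by the elements `x_α`, for all roots `α`. -/
def rootSubmonoid : Submonoid (FormalGroupRing F M) :=
  Submonoid.closure (Set.range fun i => xVar F (P.root i))

/-- The localization `Q = S[1/x_α, α ∈ Σ]`. -/
def LocalizedRing : Type _ := Localization (rootSubmonoid P F)

instance : CommRing (LocalizedRing P F) :=
  inferInstanceAs (CommRing (Localization (rootSubmonoid P F)))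

instance : Algebra (FormalGroupRing F M) (LocalizedRing P F) :=
  inferInstanceAs (Algebra (FormalGroupRing F M) (Localization (rootSubmonoid P F)))

instance : IsLocalization (rootSubmonoid P F) (LocalizedRing P F) :=
  inferInstanceAs (IsLocalization (rootSubmonoid P F) (Localization (rootSubmonoid P F)))

theorem rootSubmonoid_le_comap (w : P.weylGroup) :
    rootSubmonoid P F ≤
      (rootSubmonoid P F).comap (MulSemiringAction.toRingHom P.weylGroup (FormalGroupRing F M) w) := by
  rw [rootSubmonoid, Submonoid.closure_le]
  rintro - ⟨i, rfl⟩
  refine Submonoid.subset_closure ⟨w.1.indexEquiv i, ?_⟩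
  refine Eq.trans ?_ (smul_xVar F w (P.root i)).symm
  exact congrArg (xVar F) (RootPairing.Equiv.root_indexEquiv_eq_smul P i w.1)

/-- The extension of the automorphism `w` of `S` to `Q`. -/
def weylHom (w : P.weylGroup) : LocalizedRing P F →+* LocalizedRing P F :=
  IsLocalization.map (LocalizedRing P F) _ (rootSubmonoid_le_comap P F w)

/-- The action of the Weyl group on `Q`. -/
instance : MulSemiringAction P.weylGroup (LocalizedRing P F) where
  smul w q := weylHom P F w q
  one_smul q := by
    have : weylHom P F 1 = RingHom.id _ := by
      apply IsLocalization.ringHom_ext (rootSubmonoid P F)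
      ext s
      simp [weylHom]
    exact congrArg (fun f : LocalizedRing P F →+* LocalizedRing P F => f q) this
  mul_smul w v q := by
    have : weylHom P F (w * v) = (weylHom P F w).comp (weylHom P F v) := by
      apply IsLocalization.ringHom_ext (rootSubmonoid P F)
      ext s
      simp [weylHom, IsLocalization.map_eq, mul_smul]
    exact congrArg (fun f : LocalizedRing P F →+* LocalizedRing P F => f q) this
  smul_zero w := map_zero (weylHom P F w)
  smul_add w := map_add (weylHom P F w)
  smul_one w := map_one (weylHom P F w)
  smul_mul w := map_mul (weylHom P F w)

theorem smul_algebraMap (w : P.weylGroup) (s : FormalGroupRing F M) :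
    w • algebraMap (FormalGroupRing F M) (LocalizedRing P F) s = algebraMap _ _ (w • s) :=
  IsLocalization.map_eq (rootSubmonoid_le_comap P F w) s

theorem xVar_mem (i : ι) : xVar F (P.root i) ∈ rootSubmonoid P F :=
  Submonoid.subset_closure ⟨i, rfl⟩

/-- The element `1 / x_α` of `Q`. -/
def invX (i : ι) : LocalizedRing P F :=
  IsLocalization.mk' (LocalizedRing P F) (1 : FormalGroupRing F M)
    ⟨xVar F (P.root i), xVar_mem P F i⟩

theorem x_mul_invX (i : ι) :
    algebraMap _ (LocalizedRing P F) (xVar F (P.root i)) * invX P F i = 1 := by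
  rw [invX, IsLocalization.mk'_spec'_mk, map_one]

/-- The index of the root `-α`. -/
def negIndex (i : ι) : ι := P.reflectionPerm i i

theorem root_negIndex (i : ι) : P.root (negIndex P i) = -P.root i := by
  simp [negIndex]

/-- The localized twisted group algebra `Q_W`, with basis `δ_w`, `w ∈ W`, as a left `Q`-module and
the product given by `(q δ_w) (q' δ_v) = q w(q') δ_{wv}`. -/
abbrev TwistedGroupAlgebra : Type _ := SkewMonoidAlgebra (LocalizedRing P F) P.weylGroup

/-- The element `δ_w` of `Q_W`. -/
def delta (w : P.weylGroup) : TwistedGroupAlgebra P F := SkewMonoidAlgebra.single w 1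

/-- The embedding `q ↦ q δ_1` of `Q` into `Q_W`, restricted to `S`. -/
def scalar : FormalGroupRing F M →+* TwistedGroupAlgebra P F :=
  SkewMonoidAlgebra.singleOneRingHom.comp (algebraMap _ (LocalizedRing P F))

/-- The push-pull element `Y_α = 1 / x_{-α} + (1 / x_α) δ_{s_α}` of `Q_W`. -/
def pushPull (i : ι) : TwistedGroupAlgebra P F :=
  SkewMonoidAlgebra.single 1 (invX P F (negIndex P i)) +
    SkewMonoidAlgebra.single (RootPairing.weylGroup.ofIdx P i) (invX P F i)

/-- The formal affine Demazure algebra `D_F`: the subring of `Q_W` generated by `S` and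
the push-pull elements `Y_α`, for all roots `α`. -/
def demazureAlgebra : Subring (TwistedGroupAlgebra P F) :=
  Subring.closure (Set.range (scalar P F) ∪ Set.range (pushPull P F))

/-- The inclusion of `S` into `D_F`. -/
def scalarD : FormalGroupRing F M →+* demazureAlgebra P F :=
  (scalar P F).codRestrict _ fun s => Subring.subset_closure (Or.inl ⟨s, rfl⟩)

/-- The element `Y_α` of `D_F`. -/
def pushPullD (i : ι) : demazureAlgebra P F :=
  ⟨pushPull P F i, Subring.subset_closure (Or.inr ⟨i, rfl⟩)⟩

/-- `D_F` is a left `S`-module by left multiplication. -/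
instance : Module (FormalGroupRing F M) (demazureAlgebra P F) :=
  Module.compHom _ (scalarD P F)

theorem smul_def (s : FormalGroupRing F M) (z : demazureAlgebra P F) :
    s • z = scalarD P F s * z := rfl

/-- `F(x, 0) = x` gives `F(x, y) = x + y h(x, y)`. -/
theorem exists_eq_X_add : ∃ h : MvPowerSeries (Fin 2) R, F.toPowerSeries = X 0 + X 1 * h := by
  have : (X 1 : MvPowerSeries (Fin 2) R) ∣ F.toPowerSeries - X 0 := by
    rw [X_dvd_iff]
    intro m hm
    have hm' : m = Finsupp.single 0 (m 0) := by
      ext j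
      fin_cases j <;> simp [hm]
    have h : PowerSeries.coeff (m 0) F.Xzero = coeff m F.toPowerSeries := by
      have hs : HasSubst ![(PowerSeries.X : PowerSeries R), 0] := HasSubst.X_zero
      rw [PowerSeries.coeff, coeff_subst hs, finsum_eq_single _ m]
      · rw [Finsupp.prod_fintype _ _ (by simp)]
        simp [hm, ← PowerSeries.coeff_def, PowerSeries.coeff_X_pow]
      · intro d hd
        rw [Finsupp.prod_fintype _ _ (by simp)]
        by_cases hd1 : d 1 = 0
        · have hd0 : m 0 ≠ d 0 := by
            intro h0
            apply hd
            ext j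
            fin_cases j
            · exact h0.symm
            · exact hd1.trans hm.symm
          simp [hd1, PowerSeries.coeff_X_pow, hd0, ← PowerSeries.coeff_def]
        · simp [hd1]
    rw [map_sub, ← h, F.Xzero_eq_X, PowerSeries.coeff_X, coeff_X, sub_eq_zero]
    have h1 : m 0 = 1 ↔ m = Finsupp.single 0 1 := by
      constructor
      · intro h1
        rw [hm', h1]
      · intro h1
        simp [h1]
    simp only [h1]
  obtain ⟨h, hh⟩ := this
  exact ⟨h, by rw [← hh]; ring⟩

theorem exists_xVar_eq_mul (lam : M) :
    ∃ u : FormalGroupRing F M, xVar F lam = u * xVar F (-lam) := by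
  obtain ⟨h, hh⟩ := exists_eq_X_add F
  have hXX : HasSubst ![(X lam : MvPowerSeries M R), X (-lam)] := HasSubst.X_X
  let h' : completedPolynomialRing M R := ⟨h.subst ![(X lam : MvPowerSeries M R), X (-lam)],
    subst_mem (by intro i; fin_cases i <;> exact X_mem _) (by intro i; fin_cases i <;> simp) _⟩
  have h1 : xHatAdd F lam (-lam) = xHat R lam + xHat R (-lam) * h' := by
    apply Subtype.ext
    change F.toPowerSeries.subst ![(X lam : MvPowerSeries M R), X (-lam)]
      = X lam + X (-lam) * h.subst ![(X lam : MvPowerSeries M R), X (-lam)]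
    rw [hh, subst_add hXX, subst_mul hXX, subst_X hXX, subst_X hXX]
    simp
  have hmk : ∀ f ∈ relationIdeal F M, FormalGroupRing.mk F M f = 0 := fun f hf =>
    Ideal.Quotient.eq_zero_iff_mem.mpr (le_idealClosure _ hf)
  have h2 : FormalGroupRing.mk F M (xHat R (0 : M)) = 0 :=
    hmk _ (Ideal.subset_span (Or.inl rfl))
  have h3 := hmk _ (Ideal.subset_span (Or.inr ⟨(lam, -lam), rfl⟩))
  simp only [add_neg_cancel, map_sub, h2, h1, map_add, map_mul] at h3
  refine ⟨-FormalGroupRing.mk F M h', ?_⟩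
  simp only [xVar]
  linear_combination -h3

theorem delta_ofIdx_mem (i : ι) :
    delta P F (RootPairing.weylGroup.ofIdx P i) ∈ demazureAlgebra P F := by
  obtain ⟨u, hu⟩ := exists_xVar_eq_mul F (P.root i)
  have h1 : algebraMap _ (LocalizedRing P F) (xVar F (P.root i)) * invX P F (negIndex P i)
      = algebraMap _ _ u := by
    have := x_mul_invX P F (negIndex P i)
    rw [root_negIndex] at this
    rw [hu, map_mul, mul_assoc, this, mul_one]
  have h2 : delta P F (RootPairing.weylGroup.ofIdx P i)
      = scalar P F (xVar F (P.root i)) * pushPull P F i - scalar P F u := by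
    have hs : ∀ s, scalar P F s = SkewMonoidAlgebra.single 1 (algebraMap _ _ s) := fun _ => rfl
    rw [hs, hs, pushPull, mul_add, SkewMonoidAlgebra.single_mul_single,
      SkewMonoidAlgebra.single_mul_single, one_smul, one_smul, h1, x_mul_invX, one_mul, one_mul,
      add_sub_cancel_left]
    rfl
  rw [h2]
  exact sub_mem (mul_mem (Subring.subset_closure (Or.inl ⟨_, rfl⟩))
    (Subring.subset_closure (Or.inr ⟨i, rfl⟩))) (Subring.subset_closure (Or.inl ⟨_, rfl⟩))

/-- The elements `δ_w` lie in `D_F`, so that `S_W` is contained in `D_F`. -/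
theorem delta_mem (w : P.weylGroup) : delta P F w ∈ demazureAlgebra P F := by
  obtain ⟨w, hw⟩ := w
  induction hw using RootPairing.weylGroup.induction with
  | mem i => exact delta_ofIdx_mem P F i
  | one => exact one_mem (demazureAlgebra P F)
  | mul x y hx hy hx' hy' =>
    have : delta P F ⟨x * y, mul_mem hx hy⟩ = delta P F ⟨x, hx⟩ * delta P F ⟨y, hy⟩ := by
      rw [delta, delta, delta, SkewMonoidAlgebra.single_mul_single, smul_one, one_mul]
      rfl
    rw [this]
    exact mul_mem hx' hy'

/-- The element `δ_w` of `D_F`. -/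
def deltaD (w : P.weylGroup) : demazureAlgebra P F := ⟨delta P F w, delta_mem P F w⟩

/-- The `T`-equivariant oriented cohomology `h_T(G/B)` of the variety of complete flags for
the theory with formal group law `F`, in its algebraic model: the `S`-linear dual
`D_F^⋆ = Hom_S(D_F, S)` of the formal affine Demazure algebra. -/
abbrev EquivariantCohomology : Type _ := demazureAlgebra P F →ₗ[FormalGroupRing F M] FormalGroupRing F M

variable {P F}

/-- The Hecke action of `D_F` on `D_F^⋆`: `(z • f)(z') = f(z' z)`. -/
def hecke (z : demazureAlgebra P F) (f : EquivariantCohomology P F) : EquivariantCohomology P F where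
  toFun z' := f (z' * z)
  map_add' a b := by rw [add_mul, map_add]
  map_smul' s a := by
    rw [smul_def, mul_assoc, ← smul_def, map_smul]
    rfl

/-- The restriction to the fixed locus `D_F^⋆ → S_W^⋆ = Hom(W, S)`, `f ↦ (f(δ_w))_w`. -/
def fixedLocus (f : EquivariantCohomology P F) : P.weylGroup → FormalGroupRing F M :=
  fun w => f (deltaD P F w)

end Flag

section Localized

variable {ι M N : Type*} [AddCommGroup M] [AddCommGroup N] {P : RootDatum ι M N}
variable {R₁ R₂ : Type*} [CommRing R₁] [CommRing R₂] {F₁ : FormalGroup R₁} {F₂ : FormalGroup R₂}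

variable (P) in
/-- The operation on fixed loci `C_W : (S₁)_W^⋆ → (S₂)_W^⋆`: the operation `C` on formal group rings
applied to every component. -/
def fixedLocusOperation (c : FGLMorphism F₁ F₂) :
    (P.weylGroup → FormalGroupRing F₁ M) →+* (P.weylGroup → FormalGroupRing F₂ M) :=
  (operation c M).compLeft P.weylGroup

/-- `CT` is the localized multiplicative operation induced by `c = (φ, γ)`: the restriction to
the equivariant cohomology of the operation on fixed loci. -/
def IsLocalizedOperation (c : FGLMorphism F₁ F₂)
    (CT : EquivariantCohomology P F₁ →+ EquivariantCohomology P F₂) : Prop :=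
  ∀ z, fixedLocus (CT z) = fixedLocusOperation P c (fixedLocus z)

end Localized

end FlagOp

end

noncomputable section

namespace FlagOp

open MvPowerSeries

/-! ### Divisibility and inverses in the formal group ring -/

section FormalGroupRing

variable {R : Type*} [CommRing R] (F : FormalGroup R) {Λ : Type*} [AddCommGroup Λ]

/-! For a law of additive type `1/x_{-α} = -1/x_α`, so `Y_α = (δ_s - 1)/x_α` with `s = s_α`, and the
Hecke action becomes a divided difference on fixed points: `x_{wα} · (Y_α • f)(δ_w) = f(δ_{ws}) -
f(δ_w)`. Applying `C` and using `C(x_α) = x_α · itd(x_α)` gives `x_{wα} · w(itd(x_α)) · C((Y_α •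
f)(δ_w)) = C(f(δ_{ws})) - C(f(δ_w))` (`x_mul_itd_mul_operation_hecke`). The right side is also
`x_{wα}` times the restriction of `Y_α • C_T(f)` at `w`. Cancelling the regular element `x_{wα}`
proves the commutation formula at every fixed point.

This determines everything, because restriction to the fixed points is injective: a multiple of any
element of `D_F` by a product of root elements lies in the `S`-span of the `δ_w`
(`fixedLocus_injective`). Uniqueness follows as well.

For existence, a function `G` on `W` pairs with `Q_W` by `∑ q_w δ_w ↦ ∑ q_w G(w)`, with values in
`Q`. For `G = C ∘ f|_W` these values must lie in `S₂` on `D_{F₂}`. It suffices that `G` lies in an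
additive group of `S₂`-valued functions stable under the generators of `D_{F₂}`: then pairing with
`z` is evaluating a function of the group at the identity (`exists_pairing_mul_eq`). The group used
is generated by the functions `w ↦ w(t) · C(f(δ_w))`. Scalars clearly preserve it. For `Y_α`, a
Leibniz rule splits the difference of the values at `ws` and `w` into one term covered by the
formula above and one containing `w(s(t) - t)`. The latter is divisible by `x_{wα}` because `x_α`
divides `s(t) - t` in the completed ring (`xVar_dvd_smul_sub`). -/

theorem mk_eq_zero {f : completedPolynomialRing Λ R} :
    FormalGroupRing.mk F Λ f = 0 ↔ f ∈ idealClosure (relationIdeal F Λ) :=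
  Ideal.Quotient.eq_zero_iff_mem

theorem mk_eq_zero_of_mem {f : completedPolynomialRing Λ R} (hf : f ∈ relationIdeal F Λ) :
    FormalGroupRing.mk F Λ f = 0 :=
  (mk_eq_zero F).mpr (le_idealClosure _ hf)

theorem xVar_zero : xVar F (0 : Λ) = 0 :=
  mk_eq_zero_of_mem F (Ideal.subset_span (Or.inl rfl))

theorem xVar_add (lam mu : Λ) : xVar F (lam + mu) = FormalGroupRing.mk F Λ (xHatAdd F lam mu) := by
  have h := mk_eq_zero_of_mem F (f := xHat R (lam + mu) - xHatAdd F lam mu)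
    (Ideal.subset_span (Or.inr ⟨(lam, mu), rfl⟩))
  rwa [map_sub, sub_eq_zero] at h

/-- The formal sum `a +_F b` differs from `a` by a multiple of `b`. -/
theorem exists_subst_eq_add_mul {τ : Type*} {a b : completedPolynomialRing τ R}
    (ha : constantCoeff a.1 = 0) (hb : constantCoeff b.1 = 0) :
    ∃ u : completedPolynomialRing τ R, F.toPowerSeries.subst ![a.1, b.1] = (a + b * u).1 := by
  obtain ⟨h, hh⟩ := exists_eq_X_add F
  have hc : ∀ i, constantCoeff (![a.1, b.1] i) = 0 := by intro i; fin_cases i <;> assumption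
  have hab : HasSubst ![a.1, b.1] := hasSubst_of_constantCoeff_zero hc
  refine ⟨⟨h.subst ![a.1, b.1], subst_mem (by intro i; fin_cases i; exacts [a.2, b.2]) hc _⟩, ?_⟩
  rw [hh, subst_add hab, subst_mul hab, subst_X hab, subst_X hab]
  rfl

theorem exists_xVar_add (lam mu : Λ) :
    ∃ u : FormalGroupRing F Λ, xVar F (lam + mu) = xVar F lam + xVar F mu * u := by
  obtain ⟨u, hu⟩ := exists_subst_eq_add_mul F (a := xHat R lam) (b := xHat R mu)
    (by simp [xHat]) (by simp [xHat])
  refine ⟨FormalGroupRing.mk F Λ u, ?_⟩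
  rw [xVar_add, xVar, xVar, ← map_mul, ← map_add]
  congr 1
  exact Subtype.ext hu

theorem xVar_dvd_nsmul (lam : Λ) (k : ℕ) : xVar F lam ∣ xVar F (k • lam) := by
  induction k with
  | zero => rw [zero_smul, xVar_zero]; exact dvd_zero _
  | succ k ih =>
    obtain ⟨u, hu⟩ := exists_xVar_add F (k • lam) lam
    rw [succ_nsmul, hu]
    exact dvd_add ih (dvd_mul_right _ _)

theorem xVar_dvd_neg (lam : Λ) : xVar F lam ∣ xVar F (-lam) := by
  obtain ⟨u, hu⟩ := exists_xVar_eq_mul F (-lam)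
  rw [neg_neg] at hu
  exact ⟨u, by rw [hu, mul_comm]⟩

theorem xVar_dvd_zsmul (lam : Λ) (k : ℤ) : xVar F lam ∣ xVar F (k • lam) := by
  obtain ⟨n, rfl | rfl⟩ := k.eq_nat_or_neg
  · rw [natCast_zsmul]
    exact xVar_dvd_nsmul F lam n
  · rw [neg_smul, natCast_zsmul]
    exact (xVar_dvd_nsmul F lam n).trans (xVar_dvd_neg F _)

variable {F} in
/-- For a formal group law of additive type, `x_{-lam} = -x_lam`. -/
theorem xVar_neg (hF : IsAdditiveType F) (lam : Λ) : xVar F (-lam) = -xVar F lam := by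
  have hs : ∀ mu : Λ, PowerSeries.HasSubst (X mu : MvPowerSeries Λ R) := fun mu =>
    PowerSeries.HasSubst.of_constantCoeff_zero (by simp)
  have hsn : ∀ mu : Λ, PowerSeries.HasSubst (-X mu : MvPowerSeries Λ R) := fun mu =>
    PowerSeries.HasSubst.of_constantCoeff_zero (by simp)
  -- The hypothesis reads `F(x, -x) = 0`; substituting `-x_lam` for `x` gives the left inverse.
  have hinv : F.toPowerSeries.subst ![-X lam, (X lam : MvPowerSeries Λ R)] = 0 := by
    have h := congrArg (fun f : PowerSeries R => f.subst (-X lam : MvPowerSeries Λ R)) hF.2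
    have hXX : HasSubst ![(PowerSeries.X : PowerSeries R), -PowerSeries.X] :=
      hasSubst_of_constantCoeff_zero (by
        intro i
        fin_cases i
        · exact PowerSeries.constantCoeff_X
        · change PowerSeries.constantCoeff (-PowerSeries.X : PowerSeries R) = 0
          simp)
    simp only [PowerSeries.subst_def] at h
    rw [subst_comp_subst_apply hXX (hsn lam).const] at h
    rw [← PowerSeries.subst_def, ← PowerSeries.coe_substAlgHom (hsn lam), map_zero] at h
    rw [← h]
    congr 1
    funext i
    fin_cases i
    · exact (PowerSeries.subst_X (hsn lam)).symm
    · change _ = PowerSeries.subst (-X lam) (-PowerSeries.X : PowerSeries R)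
      rw [← PowerSeries.coe_substAlgHom (hsn lam), map_neg, PowerSeries.coe_substAlgHom,
        PowerSeries.subst_X (hsn lam), neg_neg]
      rfl
  have hcc : constantCoeff (xHatAdd F lam (-lam)).1 = 0 :=
    constantCoeff_subst_eq_zero HasSubst.X_X (by intro i; fin_cases i <;> simp)
      F.zero_constantCoeff
  -- Uniqueness of inverses: associativity for `-x_lam`, `x_lam`, `x_{-lam}` gives `x_{-lam} =
  -- (-x_lam) +_F (x_lam +_F x_{-lam})`. The bracket represents `x_0 = 0` in the quotient, and the
  -- outer sum differs from `-x_lam` by a multiple of it.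
  have hassoc := F.assoc' (hsn lam) (hs lam) (hs (-lam))
  rw [hinv, F.zero_add (hs (-lam))] at hassoc
  obtain ⟨u, hu⟩ := exists_subst_eq_add_mul F (a := -xHat R lam) (b := xHatAdd F lam (-lam))
    (by simp [xHat]) hcc
  have h : xHat R (-lam) = -xHat R lam + xHatAdd F lam (-lam) * u :=
    Subtype.ext (hassoc.trans hu)
  rw [xVar, h, map_add, map_mul, ← xVar_add, add_neg_cancel, xVar_zero, zero_mul, add_zero,
    map_neg]
  rfl

theorem smul_seriesAt {G : Type*} [Group G] [DistribMulAction G Λ] (g : G) (f : PowerSeries R)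
    (lam : Λ) : g • seriesAt F f lam = seriesAt F f (g • lam) := by
  change actHom F g _ = _
  rw [seriesAt, actHom_mk]
  congr 1
  apply Subtype.ext
  rw [coe_actHat, rename_eq_subst]
  have hs := HasSubst.X_comp (R := R) (MulAction.toPerm g : Λ ≃ Λ)
  have hl : PowerSeries.HasSubst (X lam : MvPowerSeries Λ R) :=
    PowerSeries.HasSubst.of_constantCoeff_zero (by simp)
  change subst _ (PowerSeries.subst (X lam) f) = PowerSeries.subst (X (g • lam)) f
  rw [PowerSeries.subst_def, PowerSeries.subst_def, subst_comp_subst_apply hl.const hs]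
  congr 1
  funext i
  rw [subst_X hs]
  rfl

theorem xVar_mul_seriesAt (f : PowerSeries R) (lam : Λ) :
    xVar F lam * seriesAt F f lam = seriesAt F (PowerSeries.X * f) lam := by
  have hl : PowerSeries.HasSubst (X lam : MvPowerSeries Λ R) :=
    PowerSeries.HasSubst.of_constantCoeff_zero (by simp)
  rw [xVar, seriesAt, seriesAt, ← map_mul]
  congr 1
  apply Subtype.ext
  change X lam * f.subst (X lam : MvPowerSeries Λ R) = _
  simp only [PowerSeries.subst_mul hl, PowerSeries.subst_X hl]

/-- This is `γ(x) = x · itd(x)`, the source of the Todd factor in the commutation formula. -/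
theorem operation_xVar_eq_mul {R₁ : Type*} [CommRing R₁] {F₁ : FormalGroup R₁} {F₂ : FormalGroup R}
    (c : FGLMorphism F₁ F₂) (lam : Λ) :
    operation c Λ (xVar F₁ lam) = xVar F₂ lam * seriesAt F₂ c.itd lam := by
  rw [operation_xVar, xVar_mul_seriesAt, c.X_mul_itd]

end FormalGroupRing

/-! ### Divisibility of `g s - s` by `x_α`, with control of orders -/

theorem one_le_order_xHat (R : Type*) [CommRing R] {σ : Type*} (s : σ) : 1 ≤ (xHat R s).1.order :=
  Order.one_le_iff_ne_zero.mpr (order_ne_zero_iff_constCoeff_eq_zero.mpr (by simp [xHat]))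

section Divisibility

variable {R : Type*} [CommRing R] (F : FormalGroup R) {Λ : Type*} [AddCommGroup Λ]
variable {G : Type*} [Group G] [DistribMulAction G Λ]

/-- Taking closures is idempotent, so membership may be checked in the limit. -/
theorem mem_idealClosure_of_approx {σ : Type*} {J : Ideal (completedPolynomialRing σ R)}
    {f : completedPolynomialRing σ R}
    (h : ∀ n : ℕ, ∃ j ∈ idealClosure J,
      (n : ℕ∞) ≤ ((f - j : completedPolynomialRing σ R) : MvPowerSeries σ R).order) :
    f ∈ idealClosure J := by
  intro n
  obtain ⟨j, hj, hfj⟩ := h n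
  obtain ⟨k, hk, hjk⟩ := hj n
  refine ⟨k, hk, ?_⟩
  have : ((f - k : completedPolynomialRing σ R) : MvPowerSeries σ R)
      = ((f - j : completedPolynomialRing σ R) : MvPowerSeries σ R)
        + ((j - k : completedPolynomialRing σ R) : MvPowerSeries σ R) := by
    push_cast; ring
  rw [this]
  exact le_trans (le_min hfj hjk) min_order_le_add

/-- The series `f` has order at least `n`, and `g f - f` is a multiple of `x_α` modulo the closed
ideal of relations, with a quotient of order at least `n - 1`. -/
def HasQuotient (g : G) (α : Λ) (n : ℕ) (f : completedPolynomialRing Λ R) : Prop :=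
  (n : ℕ∞) ≤ f.1.order ∧ ∃ h : completedPolynomialRing Λ R, (n : ℕ∞) ≤ h.1.order + 1 ∧
    actHat R g f - f - xHat R α * h ∈ idealClosure (relationIdeal F Λ)

variable {F} {g : G} {α : Λ} {m n : ℕ} {f f' : completedPolynomialRing Λ R}

theorem HasQuotient.zero (n : ℕ) : HasQuotient F g α n 0 :=
  ⟨by simp, 0, by simp, by simp⟩

theorem HasQuotient.mono (hmn : m ≤ n) (hf : HasQuotient F g α n f) : HasQuotient F g α m f := by
  have h : (m : ℕ∞) ≤ n := by exact_mod_cast hmn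
  obtain ⟨h1, k, hk, hk'⟩ := hf
  exact ⟨h.trans h1, k, h.trans hk, hk'⟩

theorem HasQuotient.add (hf : HasQuotient F g α n f) (hf' : HasQuotient F g α n f') :
    HasQuotient F g α n (f + f') := by
  obtain ⟨h1, k, hk, hk'⟩ := hf
  obtain ⟨h1', l, hl, hl'⟩ := hf'
  refine ⟨(le_min h1 h1').trans min_order_le_add, k + l, ?_, ?_⟩
  · refine le_trans ?_ (add_le_add_left (min_order_le_add (f := k.1) (g := l.1)) 1)
    rw [min_add]
    exact le_min hk hl
  · convert add_mem hk' hl' using 1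
    rw [map_add]
    ring

/-- Twisted Leibniz rule: `g(ff') - ff' = (gf - f) · gf' + f · (gf' - f')`. In each term only one
factor loses a degree to the division by `x_α`, so the quotient of the product again loses only one.
-/
theorem HasQuotient.mul (hf : HasQuotient F g α m f) (hf' : HasQuotient F g α n f') :
    HasQuotient F g α (m + n) (f * f') := by
  obtain ⟨h1, k, hk, hk'⟩ := hf
  obtain ⟨h1', l, hl, hl'⟩ := hf'
  refine ⟨?_, k * actHat R g f' + f * l, ?_, ?_⟩
  · rw [Nat.cast_add]
    exact (add_le_add h1 h1').trans le_order_mul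
  · have ha := h1'.trans (order_le_actHat g f')
    refine le_trans ?_ (add_le_add_left (min_order_le_add (f := (k * actHat R g f').1)
      (g := (f * l).1)) 1)
    rw [min_add, Nat.cast_add]
    refine le_min ?_ ?_
    · refine le_trans ?_ (add_le_add_left (le_order_mul (f := k.1) (g := (actHat R g f').1)) 1)
      rw [add_right_comm]
      exact add_le_add hk ha
    · refine le_trans ?_ (add_le_add_left (le_order_mul (f := f.1) (g := l.1)) 1)
      rw [add_assoc]
      exact add_le_add h1 hl
  · convert add_mem (Ideal.mul_mem_right (actHat R g f') _ hk') (Ideal.mul_mem_left _ f hl')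
      using 1
    rw [map_mul]
    ring

theorem HasQuotient.C (r : R) :
    HasQuotient F g α 0 (algebraMap R (completedPolynomialRing Λ R) r) := by
  refine ⟨by simp, 0, by simp, ?_⟩
  have : actHat R g (algebraMap R (completedPolynomialRing Λ R) r) = algebraMap _ _ r := by
    apply Subtype.ext
    rw [coe_actHat']
    exact AlgEquiv.commutes _ r
  rw [this]
  simp

theorem HasQuotient.one : HasQuotient F g α 0 (1 : completedPolynomialRing Λ R) := by
  simpa using HasQuotient.C (F := F) (g := g) (α := α) (1 : R)

/-- On a variable, `x_{lam + kα} - x_lam` is a multiple of `x_{kα}`, and `x_α` divides `x_{kα}`. No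
order bound on the quotient is needed, since the variable has order only one. -/
theorem HasQuotient.xHat {k : ℤ} {lam : Λ} (hg : g • lam = lam + k • α) :
    HasQuotient F g α 1 (xHat R lam) := by
  refine ⟨by exact_mod_cast one_le_order_xHat R lam, ?_⟩
  obtain ⟨u, hu⟩ := exists_xVar_add F lam (k • α)
  obtain ⟨v, hv⟩ := xVar_dvd_zsmul F α k
  obtain ⟨h, hh⟩ := mk_surjective F (v * u)
  refine ⟨h, by simp, ?_⟩
  rw [← mk_eq_zero, actHat_xHat, hg, map_sub, map_sub, map_mul, hh]
  change xVar F (lam + k • α) - xVar F lam - xVar F α * (v * u) = 0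
  rw [hu, hv]
  ring

theorem HasQuotient.pow (hf : HasQuotient F g α 1 f) (k : ℕ) : HasQuotient F g α k (f ^ k) := by
  induction k with
  | zero => rw [pow_zero]; exact HasQuotient.one
  | succ k ih => rw [pow_succ]; exact ih.mul hf

/-- The inclusion of the polynomial ring into its completion. -/
def ofPoly (p : MvPolynomial Λ R) : completedPolynomialRing Λ R := ⟨p, coe_mem p⟩

theorem HasQuotient.monomial (hg : ∀ lam : Λ, ∃ k : ℤ, g • lam = lam + k • α) (d : Λ →₀ ℕ) :
    HasQuotient F g α d.degree (ofPoly (MvPolynomial.monomial d (1 : R))) := by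
  induction d using Finsupp.induction_linear with
  | zero =>
    convert HasQuotient.one using 1
    · simp
    · apply Subtype.ext
      simp [ofPoly]
  | add d e hd he =>
    convert hd.mul he using 1
    · simp
    · apply Subtype.ext
      change ((MvPolynomial.monomial (d + e) (1 : R) : MvPolynomial Λ R) : MvPowerSeries Λ R)
        = (MvPolynomial.monomial d (1 : R) : MvPolynomial Λ R) * (MvPolynomial.monomial e (1 : R) : MvPolynomial Λ R)
      rw [← MvPolynomial.coe_mul, MvPolynomial.monomial_mul, one_mul]
  | single s k =>
    obtain ⟨l, hl⟩ := hg s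
    convert (HasQuotient.xHat (F := F) hl).pow k using 1
    · simp
    · apply Subtype.ext
      change ((MvPolynomial.monomial (Finsupp.single s k) (1 : R) : MvPolynomial Λ R) : MvPowerSeries Λ R) = X s ^ k
      rw [← MvPolynomial.X_pow_eq_monomial, MvPolynomial.coe_pow, MvPolynomial.coe_X]

theorem HasQuotient.sum {κ : Type*} {s : Finset κ} {f : κ → completedPolynomialRing Λ R}
    (hf : ∀ i ∈ s, HasQuotient F g α n (f i)) : HasQuotient F g α n (∑ i ∈ s, f i) :=
  Finset.sum_induction f (HasQuotient F g α n) (fun _ _ h h' => h.add h') (.zero n) hf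

theorem HasQuotient.ofPoly (hg : ∀ lam : Λ, ∃ k : ℤ, g • lam = lam + k • α)
    {p : MvPolynomial Λ R} (hp : (n : ℕ∞) ≤ (p : MvPowerSeries Λ R).order) :
    HasQuotient F g α n (FlagOp.ofPoly p) := by
  have hsum : FlagOp.ofPoly p = ∑ d ∈ p.support,
      algebraMap R (completedPolynomialRing Λ R) (p.coeff d)
        * FlagOp.ofPoly (MvPolynomial.monomial d 1) := by
    apply Subtype.ext
    rw [AddSubmonoidClass.coe_finsetSum]
    change (p : MvPowerSeries Λ R) = ∑ d ∈ p.support,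
      MvPowerSeries.C (p.coeff d) * ((MvPolynomial.monomial d (1 : R) : MvPolynomial Λ R) : MvPowerSeries Λ R)
    conv_lhs => rw [p.as_sum]
    rw [← MvPolynomial.coeToMvPowerSeries.ringHom_apply, map_sum]
    refine Finset.sum_congr rfl fun d _ => ?_
    rw [MvPolynomial.coeToMvPowerSeries.ringHom_apply, ← MvPolynomial.coe_C,
      ← MvPolynomial.coe_mul, MvPolynomial.C_mul_monomial, mul_one]
  rw [hsum]
  refine HasQuotient.sum fun d hd => ?_
  -- A polynomial of order at least `n` has only monomials of degree at least `n`, so each term has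
  -- a quotient of order at least `n - 1`.
  have hdn : n ≤ d.degree := by
    by_contra! hlt
    refine (MvPolynomial.mem_support_iff.mp hd) ?_
    rw [← MvPolynomial.coeff_coe]
    exact coeff_of_lt_order (lt_of_lt_of_le (by exact_mod_cast hlt) hp)
  have h := (HasQuotient.C (F := F) (g := g) (α := α) (p.coeff d)).mul (HasQuotient.monomial hg d)
  exact h.mono (by omega)

/-- An automorphism `g` of the lattice that moves every element by a multiple of `α` moves every
element of the formal group ring by a multiple of `x_α`. -/
theorem xVar_dvd_smul_sub (hg : ∀ lam : Λ, ∃ k : ℤ, g • lam = lam + k • α)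
    (s : FormalGroupRing F Λ) : xVar F α ∣ g • s - s := by
  obtain ⟨f, rfl⟩ := mk_surjective F s
  -- Starting the approximations at zero makes `p (N + 1)` the sum of the increments `p (n + 1) - p
  -- n`.
  obtain ⟨p, hp0, hp⟩ : ∃ p : ℕ → MvPolynomial Λ R, p 0 = 0 ∧
      ∀ n : ℕ, (n : ℕ∞) ≤ (f - ofPoly (p n)).1.order := by
    choose p hp using f.2
    refine ⟨fun n => if n = 0 then 0 else p n, rfl, fun n => ?_⟩
    rcases eq_or_ne n 0 with rfl | hn
    · simp
    · simp only [hn, if_false]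
      exact hp n
  have hq : ∀ n : ℕ, HasQuotient F g α n (ofPoly (p (n + 1)) - ofPoly (p n)) := fun n => by
    have : ofPoly (p (n + 1)) - ofPoly (p n) = ofPoly (p (n + 1) - p n) := by
      apply Subtype.ext
      change (p (n + 1) : MvPowerSeries Λ R) - (p n : MvPowerSeries Λ R)
        = ((p (n + 1) - p n : MvPolynomial Λ R) : MvPowerSeries Λ R)
      exact (map_sub MvPolynomial.coeToMvPowerSeries.ringHom _ _).symm
    have hord : (n : ℕ∞) ≤ (ofPoly (p (n + 1)) - ofPoly (p n)).1.order := by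
      have e : (ofPoly (p (n + 1)) - ofPoly (p n)).1
          = (f - ofPoly (p n)).1 + -(f - ofPoly (p (n + 1))).1 := by
        push_cast; ring
      rw [e]
      refine le_trans (le_min (hp n) ?_) min_order_le_add
      rw [order_neg]
      exact le_trans (by exact_mod_cast n.le_succ) (hp (n + 1))
    rw [this] at hord ⊢
    exact HasQuotient.ofPoly hg hord
  choose h hh hh' using fun n => (hq n).2
  -- `H` is the infinite sum of the quotients `h n`. As `h n` has order at least `n - 1`, only the
  -- indices `n ≤ d.degree + 1` contribute to the coefficient at `d`.
  let H : MvPowerSeries Λ R := fun d => ∑ n ∈ Finset.range (d.degree + 2), coeff d (h n).1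
  have hH : ∀ N : ℕ, (N : ℕ∞) ≤ (H - (∑ n ∈ Finset.range (N + 1), h n).1).order := fun N => by
    apply nat_le_order
    intro d hd
    rw [map_sub, AddSubmonoidClass.coe_finsetSum, map_sum, sub_eq_zero]
    change ∑ n ∈ Finset.range (d.degree + 2), coeff d (h n).1 = _
    refine Finset.sum_subset (Finset.range_subset_range.mpr (by omega)) fun n _ hn => ?_
    rw [Finset.mem_range, not_lt] at hn
    apply coeff_of_lt_order
    have h1 := hh n
    by_contra! hle
    have h2 : (n : ℕ∞) ≤ d.degree + 1 := h1.trans (add_le_add_left hle 1)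
    have h3 : n ≤ d.degree + 1 := by exact_mod_cast h2
    omega
  have hHmem : H ∈ completedPolynomialRing Λ R :=
    mem_of_approx fun N => ⟨_, (∑ n ∈ Finset.range (N + 1), h n).2, hH N⟩
  refine ⟨FormalGroupRing.mk F Λ ⟨H, hHmem⟩, ?_⟩
  change actHom F g _ - _ = FormalGroupRing.mk F Λ (xHat R α) * _
  rw [actHom_mk, ← map_sub, ← map_mul, ← sub_eq_zero, ← map_sub, mk_eq_zero]
  -- The `N`-th approximation is the telescoping partial sum, which lies in the closed ideal; the
  -- errors in `f` and in `H` both have order at least `N`.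
  refine mem_idealClosure_of_approx fun N => ?_
  have hsum : actHat R g (ofPoly (p (N + 1))) - ofPoly (p (N + 1))
      - xHat R α * ∑ n ∈ Finset.range (N + 1), h n ∈ idealClosure (relationIdeal F Λ) := by
    have h0 : ofPoly (p 0) = 0 := by
      apply Subtype.ext
      rw [hp0]
      exact MvPolynomial.coe_zero
    have htel : ofPoly (p (N + 1))
        = ∑ n ∈ Finset.range (N + 1), (ofPoly (p (n + 1)) - ofPoly (p n)) := by
      rw [Finset.sum_range_sub (fun n => ofPoly (p n)), h0, sub_zero]
    rw [htel, map_sum, Finset.mul_sum, ← Finset.sum_sub_distrib, ← Finset.sum_sub_distrib]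
    exact sum_mem fun n _ => hh' n
  refine ⟨_, hsum, ?_⟩
  have hN : (N : ℕ∞) ≤ (f - ofPoly (p (N + 1))).1.order :=
    le_trans (by exact_mod_cast N.le_succ) (hp (N + 1))
  have e : actHat R g f - f - xHat R α * ⟨H, hHmem⟩
        - (actHat R g (ofPoly (p (N + 1))) - ofPoly (p (N + 1))
          - xHat R α * ∑ n ∈ Finset.range (N + 1), h n)
      = actHat R g (f - ofPoly (p (N + 1))) + (-(f - ofPoly (p (N + 1)))
        + -(xHat R α * (⟨H, hHmem⟩ - ∑ n ∈ Finset.range (N + 1), h n))) := by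
    rw [map_sub]
    ring
  rw [e]
  refine le_trans (le_min (hN.trans (order_le_actHat g _)) ?_) min_order_le_add
  refine le_trans (le_min ?_ ?_) min_order_le_add
  · change _ ≤ (-(f - ofPoly (p (N + 1))).1).order
    rwa [order_neg]
  · change _ ≤ (-((xHat R α).1 * (H - (∑ n ∈ Finset.range (N + 1), h n).1))).order
    rw [order_neg]
    exact ((hH N).trans le_add_self).trans le_order_mul

end Divisibility

/-! ### The Weyl group action and push-pull elements in additive type -/

section Flag

variable {ι M N : Type*} [AddCommGroup M] [AddCommGroup N] (P : RootDatum ι M N)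
variable {R : Type*} [CommRing R] (F : FormalGroup R)

theorem exists_root_eq_smul (w : P.weylGroup) (i : ι) : ∃ j, P.root j = w • P.root i :=
  ⟨w.1.indexEquiv i, RootPairing.Equiv.root_indexEquiv_eq_smul P i w.1⟩

theorem exists_ofIdx_smul_eq (i : ι) (lam : M) :
    ∃ k : ℤ, RootPairing.weylGroup.ofIdx P i • lam = lam + k • P.root i := by
  refine ⟨-P.toLinearMap lam (P.coroot i), ?_⟩
  rw [neg_smul, ← sub_eq_add_neg]
  rfl

variable {P}

theorem weylGroup_smul_xVar (w : P.weylGroup) (lam : M) :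
    w • xVar F lam = xVar F (w • lam) :=
  smul_xVar F w lam

theorem weylGroup_smul_seriesAt (w : P.weylGroup) (f : PowerSeries R) (lam : M) :
    w • seriesAt F f lam = seriesAt F f (w • lam) :=
  smul_seriesAt F w f lam

variable (P) in
theorem xVar_dvd_ofIdx_smul_sub (i : ι) (s : FormalGroupRing F M) :
    xVar F (P.root i) ∣ RootPairing.weylGroup.ofIdx P i • s - s :=
  xVar_dvd_smul_sub (exists_ofIdx_smul_eq P i) s

variable {F}

theorem IsSigmaRegular.smul_root (h : IsSigmaRegular P F) (w : P.weylGroup) (i : ι) :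
    IsRegular (xVar F (w • P.root i)) := by
  obtain ⟨j, hj⟩ := exists_root_eq_smul P w i
  rw [← hj]
  exact h j

theorem IsSigmaRegular.isRegular_of_mem (h : IsSigmaRegular P F) {s : FormalGroupRing F M}
    (hs : s ∈ rootSubmonoid P F) : IsRegular s := by
  induction hs using Submonoid.closure_induction with
  | mem x hx =>
    obtain ⟨i, rfl⟩ := hx
    exact h i
  | one => exact isRegular_one
  | mul x y _ _ hx hy => exact hx.mul hy

theorem IsSigmaRegular.algebraMap_injective (h : IsSigmaRegular P F) :
    Function.Injective (algebraMap (FormalGroupRing F M) (LocalizedRing P F)) :=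
  IsLocalization.injective _ fun _ hs => (h.isRegular_of_mem hs).mem_nonZeroDivisors

theorem x_mul_smul_invX (w : P.weylGroup) (i : ι) :
    algebraMap _ (LocalizedRing P F) (xVar F (w • P.root i)) * w • invX P F i = 1 := by
  rw [← weylGroup_smul_xVar, ← smul_algebraMap, ← smul_mul', x_mul_invX, smul_one]

theorem smul_invX_negIndex (hF : IsAdditiveType F) (w : P.weylGroup) (i : ι) :
    w • invX P F (negIndex P i) = -(w • invX P F i) := by
  have h1 := x_mul_smul_invX (F := F) w i
  have h2 := x_mul_smul_invX (F := F) w (negIndex P i)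
  rw [root_negIndex, smul_neg, xVar_neg hF, map_neg] at h2
  linear_combination (-(w • invX P F i)) * h2 - (w • invX P F (negIndex P i)) * h1

/-- Passes from a divided difference in `S`, written without denominators, to the coefficients of
`δ_w Y_α` in `Q`. -/
theorem algebraMap_eq_of_x_mul_eq (hF : IsAdditiveType F) {w : P.weylGroup} {i : ι}
    {a b c : FormalGroupRing F M} (h : xVar F (w • P.root i) * a = b - c) :
    algebraMap _ (LocalizedRing P F) a
      = w • invX P F (negIndex P i) * algebraMap _ _ c + w • invX P F i * algebraMap _ _ b := by
  have h1 := congrArg (algebraMap _ (LocalizedRing P F)) h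
  rw [map_mul, map_sub] at h1
  rw [smul_invX_negIndex hF]
  linear_combination (w • invX P F i) * h1
    - algebraMap _ (LocalizedRing P F) a * x_mul_smul_invX (F := F) w i

theorem scalar_apply (s : FormalGroupRing F M) :
    scalar P F s = SkewMonoidAlgebra.single 1 (algebraMap _ (LocalizedRing P F) s) := rfl

/-- Moving `δ_w` past the coefficients of `Y_α` turns them into `-1/x_{wα}` and `1/x_{wα}`, the sign
coming from additive type. -/
theorem x_mul_delta_mul_pushPull (hF : IsAdditiveType F) (w : P.weylGroup) (i : ι) :
    scalarD P F (xVar F (w • P.root i)) * (deltaD P F w * pushPullD P F i)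
      = deltaD P F (w * RootPairing.weylGroup.ofIdx P i) - deltaD P F w := by
  apply Subtype.ext
  change scalar P F _ * (delta P F w * pushPull P F i)
    = delta P F (w * RootPairing.weylGroup.ofIdx P i) - delta P F w
  simp only [delta, pushPull, scalar_apply, mul_add, SkewMonoidAlgebra.single_mul_single, one_mul,
    mul_one, one_smul, smul_invX_negIndex hF, mul_neg, x_mul_smul_invX]
  rw [SkewMonoidAlgebra.single_neg, neg_add_eq_sub]

theorem deltaD_mul_scalarD (w : P.weylGroup) (s : FormalGroupRing F M) :
    deltaD P F w * scalarD P F s = scalarD P F (w • s) * deltaD P F w := by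
  apply Subtype.ext
  change delta P F w * scalar P F s = scalar P F (w • s) * delta P F w
  simp only [delta, scalar_apply, SkewMonoidAlgebra.single_mul_single, one_mul, mul_one,
    smul_one, smul_algebraMap]

theorem cohomology_scalarD_mul (f : EquivariantCohomology P F) (s : FormalGroupRing F M)
    (z : demazureAlgebra P F) : f (scalarD P F s * z) = s * f z := by
  rw [← smul_def, map_smul, smul_eq_mul]

theorem x_mul_hecke_pushPull (hF : IsAdditiveType F) (f : EquivariantCohomology P F)
    (w : P.weylGroup) (i : ι) :
    xVar F (w • P.root i) * hecke (pushPullD P F i) f (deltaD P F w)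
      = f (deltaD P F (w * RootPairing.weylGroup.ofIdx P i)) - f (deltaD P F w) := by
  rw [← map_sub, ← x_mul_delta_mul_pushPull hF, cohomology_scalarD_mul]
  rfl

theorem hecke_scalarD_apply (s : FormalGroupRing F M) (f : EquivariantCohomology P F)
    (w : P.weylGroup) : hecke (scalarD P F s) f (deltaD P F w) = (w • s) * f (deltaD P F w) := by
  change f (deltaD P F w * scalarD P F s) = _
  rw [deltaD_mul_scalarD, cohomology_scalarD_mul]

/-! ### Injectivity of the restriction to the fixed points -/

/-- Every element of `D_F` has a multiple by a product of root elements in the `S`-span of the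
elements `δ_w`. -/
theorem exists_scalar_mul_mem (z : TwistedGroupAlgebra P F) :
    ∃ s ∈ rootSubmonoid P F, scalar P F s * z ∈
      AddSubmonoid.closure (Set.range fun p : FormalGroupRing F M × P.weylGroup =>
        scalar P F p.1 * delta P F p.2) := by
  set A := AddSubmonoid.closure (Set.range fun p : FormalGroupRing F M × P.weylGroup =>
        scalar P F p.1 * delta P F p.2)
  have hA : ∀ (t : FormalGroupRing F M) (y : TwistedGroupAlgebra P F), y ∈ A →
      scalar P F t * y ∈ A := fun t y hy => by
    induction hy using AddSubmonoid.closure_induction with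
    | mem x hx =>
      obtain ⟨⟨s, w⟩, rfl⟩ := hx
      refine AddSubmonoid.subset_closure ⟨(t * s, w), ?_⟩
      simp only [map_mul, mul_assoc]
    | zero => rw [mul_zero]; exact zero_mem _
    | add x y _ _ hx hy => rw [mul_add]; exact add_mem hx hy
  induction z using SkewMonoidAlgebra.induction_on with
  | zero => exact ⟨1, one_mem _, by rw [mul_zero]; exact zero_mem _⟩
  | single w q =>
    obtain ⟨⟨t, s⟩, hts⟩ := IsLocalization.surj (rootSubmonoid P F) q
    refine ⟨s, s.2, AddSubmonoid.subset_closure ⟨(t, w), ?_⟩⟩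
    simp only [scalar_apply, delta, SkewMonoidAlgebra.single_mul_single, one_mul, one_smul, ← hts,
      mul_comm]
  | add x y hx hy =>
    obtain ⟨s, hs, hsx⟩ := hx
    obtain ⟨t, ht, hty⟩ := hy
    refine ⟨s * t, mul_mem hs ht, ?_⟩
    have e : scalar P F (s * t) * (x + y)
        = scalar P F t * (scalar P F s * x) + scalar P F s * (scalar P F t * y) := by
      rw [mul_add, ← mul_assoc, ← mul_assoc, ← map_mul, ← map_mul, mul_comm t s]
    rw [e]
    exact add_mem (hA _ _ hsx) (hA _ _ hty)

/-- If `S` is `Σ`-regular, the restriction to the fixed locus is injective. -/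
theorem fixedLocus_injective (hS : IsSigmaRegular P F) :
    Function.Injective (fixedLocus (P := P) (F := F)) := by
  intro f f' hff'
  refine LinearMap.ext fun z => ?_
  obtain ⟨s, hs, hz⟩ := exists_scalar_mul_mem z.1
  apply (hS.isRegular_of_mem hs).left
  change s * f z = s * f' z
  rw [← cohomology_scalarD_mul, ← cohomology_scalarD_mul]
  -- The span lives in `Q_W`, whereas `f` and `f'` are defined only on `D_F`; membership in `D_F` is
  -- therefore carried along in the induction.
  have key : ∀ y ∈ AddSubmonoid.closure (Set.range fun p : FormalGroupRing F M × P.weylGroup =>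
      scalar P F p.1 * delta P F p.2), ∃ hy : y ∈ demazureAlgebra P F, f ⟨y, hy⟩ = f' ⟨y, hy⟩ := by
    intro y hy
    induction hy using AddSubmonoid.closure_induction with
    | mem x hx =>
      obtain ⟨⟨t, w⟩, rfl⟩ := hx
      refine ⟨(scalarD P F t * deltaD P F w).2, ?_⟩
      change f (scalarD P F t * deltaD P F w) = f' (scalarD P F t * deltaD P F w)
      rw [cohomology_scalarD_mul, cohomology_scalarD_mul]
      exact congrArg (t * ·) (congrFun hff' w)
    | zero => exact ⟨zero_mem _, (map_zero f).trans (map_zero f').symm⟩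
    | add x y _ _ hx hy =>
      obtain ⟨hx, hfx⟩ := hx
      obtain ⟨hy, hfy⟩ := hy
      refine ⟨add_mem hx hy, ?_⟩
      change f (⟨x, hx⟩ + ⟨y, hy⟩) = f' (⟨x, hx⟩ + ⟨y, hy⟩)
      rw [map_add, map_add, hfx, hfy]
  exact (key _ hz).2

/-! ### The pairing of `Q_W` with functions on `W` -/

/-- The pairing `∑ q_w δ_w ↦ ∑ q_w G(w)` of `Q_W` with a function `G` on the fixed locus. -/
def pairing (G : P.weylGroup → FormalGroupRing F M) :
    TwistedGroupAlgebra P F →+ LocalizedRing P F :=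
  SkewMonoidAlgebra.liftNC (AddMonoidHom.id _) fun w => algebraMap _ _ (G w)

theorem pairing_single (G : P.weylGroup → FormalGroupRing F M) (w : P.weylGroup)
    (q : LocalizedRing P F) :
    pairing G (SkewMonoidAlgebra.single w q) = q * algebraMap _ _ (G w) :=
  SkewMonoidAlgebra.liftNC_single _ _ _ _

theorem pairing_add (G G' : P.weylGroup → FormalGroupRing F M) :
    pairing (G + G') = pairing G + pairing G' := by
  refine SkewMonoidAlgebra.addHom_ext fun w q => ?_
  simp only [AddMonoidHom.add_apply, pairing_single, Pi.add_apply, map_add, mul_add]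

theorem pairing_neg (G : P.weylGroup → FormalGroupRing F M) : pairing (-G) = -pairing G := by
  refine SkewMonoidAlgebra.addHom_ext fun w q => ?_
  simp only [AddMonoidHom.neg_apply, pairing_single, Pi.neg_apply, map_neg, mul_neg]

theorem pairing_zero : pairing (0 : P.weylGroup → FormalGroupRing F M) = 0 := by
  refine SkewMonoidAlgebra.addHom_ext fun w q => ?_
  simp only [AddMonoidHom.zero_apply, pairing_single, Pi.zero_apply, map_zero, mul_zero]

theorem pairing_scalar_mul (G : P.weylGroup → FormalGroupRing F M) (s : FormalGroupRing F M)
    (z : TwistedGroupAlgebra P F) :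
    pairing G (scalar P F s * z) = algebraMap _ _ s * pairing G z := by
  have : (pairing G).comp (AddMonoidHom.mulLeft (scalar P F s))
      = (AddMonoidHom.mulLeft (algebraMap _ (LocalizedRing P F) s)).comp (pairing G) := by
    refine SkewMonoidAlgebra.addHom_ext fun w q => ?_
    simp only [AddMonoidHom.comp_apply, AddMonoidHom.coe_mulLeft, scalar_apply, pairing_single,
      SkewMonoidAlgebra.single_mul_single, one_mul, one_smul, mul_assoc]
  exact DFunLike.congr_fun this z

/-- A criterion for `D_F` to act on an additive group of functions on the fixed locus. -/
theorem exists_pairing_mul_eq {s : Set (P.weylGroup → FormalGroupRing F M)}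
    (hscalar : ∀ G ∈ s, ∀ t : FormalGroupRing F M,
      (fun w => (w • t) * G w) ∈ AddSubgroup.closure s)
    (hpushPull : ∀ G ∈ s, ∀ i, ∃ G' ∈ AddSubgroup.closure s, ∀ w,
      algebraMap _ (LocalizedRing P F) (G' w) = w • invX P F (negIndex P i) * algebraMap _ _ (G w)
        + w • invX P F i * algebraMap _ _ (G (w * RootPairing.weylGroup.ofIdx P i)))
    {z : TwistedGroupAlgebra P F} (hz : z ∈ demazureAlgebra P F)
    {G : P.weylGroup → FormalGroupRing F M} (hG : G ∈ AddSubgroup.closure s) :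
    ∃ G' ∈ AddSubgroup.closure s, ∀ y, pairing G (y * z) = pairing G' y := by
  -- For fixed `z` the condition is additive in `G`, so it need only be checked on `s`. The
  -- hypotheses supply this for the generators `z` of `D_F`; the induction on `z` then varies `G`
  -- over the whole group, as products require.
  have hgen : ∀ z : TwistedGroupAlgebra P F,
      (∀ G ∈ s, ∃ G' ∈ AddSubgroup.closure s, ∀ y, pairing G (y * z) = pairing G' y) →
      ∀ G ∈ AddSubgroup.closure s,
        ∃ G' ∈ AddSubgroup.closure s, ∀ y, pairing G (y * z) = pairing G' y := by
    intro z h G hG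
    induction hG using AddSubgroup.closure_induction with
    | mem G hG => exact h G hG
    | zero => exact ⟨0, zero_mem _, fun y => by simp [pairing_zero]⟩
    | add G₁ G₂ _ _ h₁ h₂ =>
      obtain ⟨G₁', hG₁', h₁⟩ := h₁
      obtain ⟨G₂', hG₂', h₂⟩ := h₂
      refine ⟨G₁' + G₂', add_mem hG₁' hG₂', fun y => ?_⟩
      simp only [pairing_add, AddMonoidHom.add_apply, h₁, h₂]
    | neg G _ h =>
      obtain ⟨G', hG', h⟩ := h
      refine ⟨-G', neg_mem hG', fun y => ?_⟩
      simp only [pairing_neg, AddMonoidHom.neg_apply, h]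
  induction hz using Subring.closure_induction generalizing G with
  | mem z hz =>
    refine hgen z (fun G hG => ?_) G hG
    rcases hz with ⟨t, rfl⟩ | ⟨i, rfl⟩
    · refine ⟨_, hscalar G hG t, fun y => ?_⟩
      induction y using SkewMonoidAlgebra.induction_on with
      | zero => simp
      | add x y hx hy => rw [add_mul, map_add, map_add, hx, hy]
      | single w q =>
        rw [scalar_apply, SkewMonoidAlgebra.single_mul_single, pairing_single, pairing_single,
          mul_one, smul_algebraMap, map_mul, mul_assoc]
    · obtain ⟨G', hG', h⟩ := hpushPull G hG i
      refine ⟨G', hG', fun y => ?_⟩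
      induction y using SkewMonoidAlgebra.induction_on with
      | zero => simp
      | add x y hx hy => rw [add_mul, map_add, map_add, hx, hy]
      | single w q =>
        rw [pushPull, mul_add, SkewMonoidAlgebra.single_mul_single,
          SkewMonoidAlgebra.single_mul_single, map_add, pairing_single, pairing_single,
          pairing_single, h, mul_one]
        ring
  | zero => exact ⟨0, zero_mem _, fun y => by simp [pairing_zero]⟩
  | one => exact ⟨G, hG, fun y => by rw [mul_one]⟩
  | add z₁ z₂ _ _ h₁ h₂ =>
    obtain ⟨G₁, hG₁, h₁⟩ := h₁ hG
    obtain ⟨G₂, hG₂, h₂⟩ := h₂ hG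
    refine ⟨G₁ + G₂, add_mem hG₁ hG₂, fun y => ?_⟩
    simp only [mul_add, map_add, pairing_add, AddMonoidHom.add_apply, h₁, h₂]
  | neg z _ h =>
    obtain ⟨G', hG', h⟩ := h hG
    refine ⟨-G', neg_mem hG', fun y => ?_⟩
    simp only [mul_neg, map_neg, pairing_neg, AddMonoidHom.neg_apply, h]
  | mul z₁ z₂ _ _ h₁ h₂ =>
    obtain ⟨G₂, hG₂, h₂⟩ := h₂ hG
    obtain ⟨G₁, hG₁, h₁⟩ := h₁ hG₂
    exact ⟨G₁, hG₁, fun y => by rw [← mul_assoc, h₂, h₁]⟩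

end Flag

/-! ### Existence of the localized operation -/

section Localized

variable {ι M N : Type*} [AddCommGroup M] [AddCommGroup N] {P : RootDatum ι M N}
variable {R₁ R₂ : Type*} [CommRing R₁] [CommRing R₂] {F₁ : FormalGroup R₁} {F₂ : FormalGroup R₂}

theorem x_mul_itd_mul_operation_hecke (hF₁ : IsAdditiveType F₁) (c : FGLMorphism F₁ F₂)
    (f : EquivariantCohomology P F₁) (w : P.weylGroup) (i : ι) :
    xVar F₂ (w • P.root i) * (w • seriesAt F₂ c.itd (P.root i)
        * operation c M (hecke (pushPullD P F₁ i) f (deltaD P F₁ w)))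
      = operation c M (f (deltaD P F₁ (w * RootPairing.weylGroup.ofIdx P i)))
        - operation c M (f (deltaD P F₁ w)) := by
  rw [← map_sub, ← x_mul_hecke_pushPull hF₁, map_mul, operation_xVar_eq_mul, weylGroup_smul_seriesAt,
    mul_assoc]

theorem exists_algebraMap_eq_pairing_operation (hF₁ : IsAdditiveType F₁) (hF₂ : IsAdditiveType F₂)
    (c : FGLMorphism F₁ F₂) (f : EquivariantCohomology P F₁) (z : demazureAlgebra P F₂) :
    ∃ t : FormalGroupRing F₂ M, algebraMap _ (LocalizedRing P F₂) t
      = pairing (fixedLocusOperation P c (fixedLocus f)) z.1 := by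
  -- The functions `C ∘ f|_W` alone need not be stable under scalars from `S₂`, which act on
  -- functions by `w ↦ w(t)`; the factor `w • p.1` builds this in.
  let s : Set (P.weylGroup → FormalGroupRing F₂ M) :=
    Set.range fun p : FormalGroupRing F₂ M × EquivariantCohomology P F₁ =>
      fun w => (w • p.1) * operation c M (p.2 (deltaD P F₁ w))
  have hs : ∀ (t : FormalGroupRing F₂ M) (f : EquivariantCohomology P F₁),
      (fun w : P.weylGroup => (w • t) * operation c M (f (deltaD P F₁ w)))
        ∈ AddSubgroup.closure s := fun t f => AddSubgroup.subset_closure ⟨(t, f), rfl⟩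
  have hf : fixedLocusOperation P c (fixedLocus f) ∈ AddSubgroup.closure s := by
    have h := hs 1 f
    simp only [smul_one, one_mul] at h
    exact h
  have hscalar : ∀ G ∈ s, ∀ t : FormalGroupRing F₂ M,
      (fun w => (w • t) * G w) ∈ AddSubgroup.closure s := by
    rintro - ⟨⟨t, f⟩, rfl⟩ u
    have h := hs (u * t) f
    simp only [smul_mul', mul_assoc] at h
    exact h
  have hpushPull : ∀ G ∈ s, ∀ i, ∃ G' ∈ AddSubgroup.closure s, ∀ w,
      algebraMap _ (LocalizedRing P F₂) (G' w)
        = w • invX P F₂ (negIndex P i) * algebraMap _ _ (G w)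
          + w • invX P F₂ i * algebraMap _ _ (G (w * RootPairing.weylGroup.ofIdx P i)) := by
    rintro - ⟨⟨t, f⟩, rfl⟩ i
    obtain ⟨u, hu⟩ := xVar_dvd_ofIdx_smul_sub P F₂ i t
    -- The two summands come from `ws(t) C(f(δ_{ws})) - w(t) C(f(δ_w)) = ws(t) (C(f(δ_{ws})) -
    -- C(f(δ_w))) + w(s(t) - t) C(f(δ_w))`, divided by `x_{wα}`. The first is the generator attached
    -- to `Y_α • f` and `s(t) · itd(x_α)`, the second the one attached to `f` and `u`.
    refine ⟨_, add_mem (hs (RootPairing.weylGroup.ofIdx P i • t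
      * seriesAt F₂ c.itd (P.root i)) (hecke (pushPullD P F₁ i) f)) (hs u f), fun w => ?_⟩
    have h1 := x_mul_itd_mul_operation_hecke hF₁ c f w i
    have h2 := congrArg (w • ·) hu
    simp only [smul_sub, smul_mul', ← mul_smul, weylGroup_smul_xVar] at h2
    have h3 : xVar F₂ (w • P.root i)
        * (w • (RootPairing.weylGroup.ofIdx P i • t * seriesAt F₂ c.itd (P.root i))
            * operation c M (hecke (pushPullD P F₁ i) f (deltaD P F₁ w))
          + w • u * operation c M (f (deltaD P F₁ w)))
        = (w * RootPairing.weylGroup.ofIdx P i) • t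
            * operation c M (f (deltaD P F₁ (w * RootPairing.weylGroup.ofIdx P i)))
          - w • t * operation c M (f (deltaD P F₁ w)) := by
      rw [smul_mul', ← mul_smul]
      linear_combination ((w * RootPairing.weylGroup.ofIdx P i) • t) * h1
        - operation c M (f (deltaD P F₁ w)) * h2
    exact algebraMap_eq_of_x_mul_eq hF₂ h3
  obtain ⟨G, -, hG⟩ := exists_pairing_mul_eq hscalar hpushPull z.2 hf
  -- With `y = 1 = δ_1`, pairing the original function with `z` gives the value at the identity of a
  -- function with values in `S₂`.
  refine ⟨G 1, ?_⟩
  have h := hG 1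
  rw [one_mul, SkewMonoidAlgebra.one_def, pairing_single, one_mul] at h
  exact h.symm

/-- A morphism of formal group laws of additive type induces a localized operation. -/
theorem exists_isLocalizedOperation (hF₁ : IsAdditiveType F₁) (hF₂ : IsAdditiveType F₂)
    (hS₂ : IsSigmaRegular P F₂) (c : FGLMorphism F₁ F₂) :
    ∃ CT : EquivariantCohomology P F₁ →+ EquivariantCohomology P F₂,
      IsLocalizedOperation c CT := by
  have hinj := hS₂.algebraMap_injective
  -- Since `S₂` embeds in `Q` by regularity, the values `T f z` are unique, and linearity in `z` and
  -- additivity in `f` are inherited from the pairing.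
  choose T hT using exists_algebraMap_eq_pairing_operation (P := P) hF₁ hF₂ c
  refine ⟨AddMonoidHom.mk' (fun f =>
    { toFun := T f
      map_add' := fun x y => hinj ?_
      map_smul' := fun s x => hinj ?_ }) fun f f' => ?_, fun f => funext fun w => hinj ?_⟩
  · rw [map_add, hT, hT, hT, ← map_add]
    rfl
  · rw [RingHom.id_apply, smul_eq_mul, map_mul, hT, hT, ← pairing_scalar_mul]
    rfl
  · refine LinearMap.ext fun z => hinj ?_
    change algebraMap _ _ (T (f + f') z) = algebraMap _ _ (T f z + T f' z)
    rw [map_add, hT, hT, hT, ← AddMonoidHom.add_apply, ← pairing_add, ← map_add]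
    rfl
  · change algebraMap _ _ (T f (deltaD P F₂ w)) = _
    rw [hT]
    exact (pairing_single _ _ _).trans (one_mul _)

theorem IsLocalizedOperation.apply_deltaD {c : FGLMorphism F₁ F₂}
    {CT : EquivariantCohomology P F₁ →+ EquivariantCohomology P F₂}
    (h : IsLocalizedOperation c CT) (f : EquivariantCohomology P F₁) (w : P.weylGroup) :
    CT f (deltaD P F₂ w) = operation c M (f (deltaD P F₁ w)) :=
  congrFun (h f) w

end Localized

end FlagOp

end

theorem proposition6p2 {ι M N R₁ R₂ : Type*} [Finite ι]
    [AddCommGroup M] [Module.Finite ℤ M] [AddCommGroup N] [Module.Finite ℤ N]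
    [CommRing R₁] [CommRing R₂]
    (P : RootDatum ι M N) [P.IsReduced] (hP : FlagOp.IsSemisimple P)
    (F₁ : FormalGroup R₁) [F₁.IsComm] (F₂ : FormalGroup R₂) [F₂.IsComm]
    (hF₁ : FlagOp.IsAdditiveType F₁) (hF₂ : FlagOp.IsAdditiveType F₂)
    (hS₁ : FlagOp.IsSigmaRegular P F₁) (hS₂ : FlagOp.IsSigmaRegular P F₂)
    (c : FlagOp.FGLMorphism F₁ F₂) :
    (∃! CT : FlagOp.EquivariantCohomology P F₁ →+ FlagOp.EquivariantCohomology P F₂,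
      FlagOp.IsLocalizedOperation c CT) ∧
    ∀ CT : FlagOp.EquivariantCohomology P F₁ →+ FlagOp.EquivariantCohomology P F₂,
      FlagOp.IsLocalizedOperation c CT →
      ∀ (i : ι) (z : FlagOp.EquivariantCohomology P F₁),
        FlagOp.hecke (FlagOp.scalarD P F₂ (FlagOp.seriesAt F₂ c.itd (P.root i)))
            (CT (FlagOp.hecke (FlagOp.pushPullD P F₁ i) z))
          = FlagOp.hecke (FlagOp.pushPullD P F₂ i) (CT z) := by
  refine ⟨?_, fun CT hCT i z => FlagOp.fixedLocus_injective hS₂ (funext fun w => ?_)⟩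
  · obtain ⟨CT, hCT⟩ := FlagOp.exists_isLocalizedOperation hF₁ hF₂ hS₂ c
    refine ⟨CT, hCT, fun CT' hCT' => AddMonoidHom.ext fun f => ?_⟩
    exact FlagOp.fixedLocus_injective hS₂ ((hCT' f).trans (hCT f).symm)
  -- After multiplication by the regular element `x_{wα}`, both sides become `C(z(δ_{ws})) -
  -- C(z(δ_w))`.
  · apply (hS₂.smul_root w i).left
    change FlagOp.xVar F₂ (w • P.root i) * FlagOp.hecke _ _ (FlagOp.deltaD P F₂ w)
      = FlagOp.xVar F₂ (w • P.root i) * FlagOp.hecke _ _ (FlagOp.deltaD P F₂ w)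
    rw [FlagOp.hecke_scalarD_apply, hCT.apply_deltaD,
      FlagOp.x_mul_itd_mul_operation_hecke hF₁, FlagOp.x_mul_hecke_pushPull hF₂,
      hCT.apply_deltaD, hCT.apply_deltaD]
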